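/- **Theorem 1.** Let $F:\mathbb{C}\to\mathbb{C}$ be a real entire function (that is, an entire function that is real-valued on $\mathbb{R}$) such that: (i) $F$ has exponential type at most $2\pi$, i.e. $\limsup_{|z|\to\infty} |z|^{-1}\log|F(z)| \le 2\pi$; (ii) $F(x)\ge \operatorname{sgn}(x)$ for all $x\in\mathbb{R}$; (iii) $F$ is non-decreasing on $(-\infty,0)$ and non-increasing on $(0,\infty)$. Then $$\int_{-\infty}^{\infty}\{F(x)-\operatorname{sgn}(x)\}\,dx \ \ge\ 2,$$ where the integral of this non-negative function is allowed to be $+\infty$. Moreover, there exists a unique real entire function $M:\mathbb{C}\to\mathbb{C}$ satisfying (i), (ii) and (iii) for which equality holds. It is given by $$M(z) = -2\int_{-\infty}^{z}\frac{\sin^2 (\pi s)}{\pi^2\, s\,(s+1)^2}\,ds - 1,$$ where the (absolutely convergent) integral is taken along the path $(-\infty,0]\cup[0,z]$, the latter being the line segment from $0$ to $z$. -/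

import Mathlib

open MeasureTheory Set Filter

noncomputable section

/-- The exponential type `limsup_{|z| → ∞} |z|⁻¹ log |F z|` of a function `F : ℂ → ℂ`, as an
extended real number (with `log 0 = -∞`). -/
def exponentialType (F : ℂ → ℂ) : EReal :=
  limsup (fun z : ℂ => ENNReal.log ‖F z‖ₑ / ((‖z‖ : ℝ) : EReal)) (Bornology.cobounded ℂ)

/-- Real entire functions: entire functions that are real-valued on the real line. -/
structure IsRealEntire (F : ℂ → ℂ) : Prop where
  differentiable : Differentiable ℂ F
  im_eq_zero : ∀ x : ℝ, (F (x : ℂ)).im = 0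

/-- The real entire functions `F` with properties (i) exponential type at most `2π`,
(ii) `F ≥ sgn` on the real line, (iii) `F` is non-decreasing on `(-∞, 0)` and non-increasing on
`(0, ∞)`. -/
structure IsMonotoneSignMajorant (F : ℂ → ℂ) : Prop where
  realEntire : IsRealEntire F
  exponentialType_le : exponentialType F ≤ ((2 * Real.pi : ℝ) : EReal)
  sign_le : ∀ x : ℝ, Real.sign x ≤ (F (x : ℂ)).re
  monotoneOn : MonotoneOn (fun x : ℝ => (F (x : ℂ)).re) (Iio 0)
  antitoneOn : AntitoneOn (fun x : ℝ => (F (x : ℂ)).re) (Ioi 0)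

/-- The integral over the real line of `F - sgn`, as an element of `[0, ∞]`. It is only used for
functions `F` that satisfy `F ≥ sgn` on the real line, so that the integrand is non-negative. -/
def signExcess (F : ℂ → ℂ) : ENNReal :=
  ∫⁻ x : ℝ, ENNReal.ofReal ((F (x : ℂ)).re - Real.sign x)

/-- The integrand `sin² (π s) / (π² s (s + 1)²)`. Its singularities at `s = 0` and `s = -1` are
removable; the values assigned to these two points are irrelevant for the path integrals below. -/
def extremalKernel (s : ℂ) : ℂ :=
  Complex.sin (Real.pi * s) ^ 2 / ((Real.pi : ℂ) ^ 2 * s * (s + 1) ^ 2)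

/-- `M z = -2 ∫_{-∞}^z sin² (π s) / (π² s (s + 1)²) ds - 1`, the integral being taken along the
half-line `(-∞, 0]` followed by the line segment from `0` to `z`, parametrized by `t ↦ t z`. -/
def extremalM (z : ℂ) : ℂ :=
  -2 * ((∫ s : ℝ in Iic 0, extremalKernel (s : ℂ)) +
    ∫ t : ℝ in (0 : ℝ)..1, extremalKernel ((t : ℂ) * z) * z) - 1

end

/-!
Let `F` be a monotone majorant of the signum function of finite excess. Then `F → ±1` at `±∞`, so
`∫ F' = 2` (`integral_re_deriv`), and integration by parts on each half-line turns the excess into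
`∫ -x F'(x) dx` with a non-negative integrand (`signExcess_eq_ofReal`). Both `F'` and `z F'(z)` have
type `2π`, and for such functions Poisson summation equates the integral with the sum over the
integers. Hence, formally,

  `excess - 2 = ∫ -(x + 1) F'(x) dx = ∑ n, -(n + 1) F'(n)`,

and every term on the right is non-negative, because `F'` is `≥ 0` to the left and `≤ 0` to the right
of the origin, and no integer lies strictly between `-1` and `0`. This is the lower bound, and in case of equality `F'(n) = 0` for all integers
`n ≠ -1`. To avoid convergence questions the summation formula is applied to the function
`-(z + δ) F'(z)`, damped by the fourth power of a dilated sinc function and sampled with a step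
`δ < 1`; the inequalities for single terms survive in the limit (`neg_add_one_mul_re_deriv_le`).
The decay required for the summation formula (`hasSum_int_smul`, proved by moving the contour of the
Fourier integral to infinity) comes from the damping and from the Phragmén–Lindelöf bound
`|F (x + iy)| ≤ C exp (2π |y|)`, as `F` is bounded on the real line.

In the case of equality, the sign of `F'` forces the zeros at the integers other than `0` and `-1` to
be double. So `F'(z) z (z + 1)² / sin² (π z)` is entire (`exists_eq_mul_sin_sq`), has polynomial
growth, and is constant since `x F'(x)` is integrable (`exists_const_deriv`). As `∫ F' = 2` this
determines `F'`, and `F (-∞) = -1` then determines `F`.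

Conversely, `extremalM` has derivative `-2 E`, where `E` is the entire extension of `extremalKernel`.
Its limits at infinity and its excess follow from `∫ E = -1` and the normalization of the Fejér
kernel, both instances of the summation formula in which a single integer contributes.
-/

/-! ### Exponential type and growth on horizontal lines -/

lemma ennreal_log_enorm_div_le_iff {w z : ℂ} (hz : z ≠ 0) (a : ℝ) :
    ENNReal.log ‖w‖ₑ / ((‖z‖ : ℝ) : EReal) ≤ (a : EReal) ↔ ‖w‖ ≤ Real.exp (a * ‖z‖) := by
  have hz' : 0 < ‖z‖ := norm_pos_iff.mpr hz
  rw [EReal.div_le_iff_le_mul (by exact_mod_cast hz') (EReal.coe_ne_top _)]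
  rw [show ((‖z‖ : ℝ) : EReal) * (a : EReal) = ((‖z‖ * a : ℝ) : EReal) from (EReal.coe_mul _ _).symm]
  rw [← ofReal_norm, ENNReal.log_ofReal]
  split_ifs with h
  · simp only [bot_le, true_iff]
    exact h.trans (Real.exp_pos _).le
  · push Not at h
    rw [EReal.coe_le_coe_iff, Real.log_le_iff_le_exp h, mul_comm]

lemma eventually_norm_le_exp_of_exponentialType_le {F : ℂ → ℂ} {τ ε : ℝ}
    (h : exponentialType F ≤ (τ : EReal)) (hε : 0 < ε) :
    ∀ᶠ z in Bornology.cobounded ℂ, ‖F z‖ ≤ Real.exp ((τ + ε) * ‖z‖) := by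
  have h1 : exponentialType F < ((τ + ε : ℝ) : EReal) :=
    h.trans_lt (by exact_mod_cast (by linarith : τ < τ + ε))
  filter_upwards [eventually_lt_of_limsup_lt h1, Bornology.eventually_ne_cobounded 0] with z hz hz0
  exact (ennreal_log_enorm_div_le_iff hz0 _).1 hz.le

lemma exponentialType_le_of_eventually {F : ℂ → ℂ} {τ : ℝ}
    (h : ∀ ε > 0, ∀ᶠ z in Bornology.cobounded ℂ, ‖F z‖ ≤ Real.exp ((τ + ε) * ‖z‖)) :
    exponentialType F ≤ (τ : EReal) := by
  refine EReal.le_of_forall_lt_iff_le.1 fun a ha => ?_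
  have ha' : τ < a := by exact_mod_cast ha
  refine limsup_le_of_le (by isBoundedDefault) ?_
  filter_upwards [h (a - τ) (by linarith), Bornology.eventually_ne_cobounded 0] with z hz hz0
  rw [ennreal_log_enorm_div_le_iff hz0]
  simpa using hz

/-- The Phragmén–Lindelöf principle, applied to `F (i w) exp (-a w)` in the right half-plane, which is
bounded on the positive real axis and on the imaginary axis. -/
lemma norm_le_exp_im_of_im_nonneg {F : ℂ → ℂ} (hF : Differentiable ℂ F) {a C : ℝ}
    (hexp : ∀ᶠ z in Bornology.cobounded ℂ, ‖F z‖ ≤ Real.exp (a * ‖z‖))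
    (hC : ∀ x : ℝ, ‖F x‖ ≤ C) {z : ℂ} (hz : 0 ≤ z.im) :
    ‖F z‖ ≤ C * Real.exp (a * z.im) := by
  set f : ℂ → ℂ := fun w => F (Complex.I * w) * Complex.exp (-(a : ℂ) * w) with hf
  have hfd : Differentiable ℂ f := by
    refine Differentiable.mul (hF.comp (by fun_prop)) (by fun_prop)
  have hnorm : ∀ w : ℂ, ‖f w‖ = ‖F (Complex.I * w)‖ * Real.exp (-a * w.re) := by
    intro w
    rw [hf, norm_mul, Complex.norm_exp]
    simp
  have hI : Tendsto (fun w : ℂ => Complex.I * w) (Bornology.cobounded ℂ) (Bornology.cobounded ℂ) := by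
    rw [← tendsto_norm_atTop_iff_cobounded]
    simpa using tendsto_norm_cobounded_atTop
  have hev : ∀ᶠ w in Bornology.cobounded ℂ,
      ‖f w‖ ≤ Real.exp (a * ‖w‖) * Real.exp (-a * w.re) := by
    filter_upwards [hI.eventually hexp] with w hw
    rw [hnorm]
    gcongr
    simpa using hw
  have key : ‖f (-Complex.I * z)‖ ≤ C := by
    refine PhragmenLindelof.right_half_plane_of_bounded_on_real hfd.diffContOnCl
      ⟨1, by norm_num, 2 * |a|, ?_⟩ ?_ ?_ (by simpa using hz)
    · refine Asymptotics.IsBigO.of_bound 1 ?_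
      filter_upwards [hev.filter_mono inf_le_left] with w hw
      refine hw.trans ?_
      rw [← Real.exp_add, one_mul, Real.norm_of_nonneg (Real.exp_pos _).le, Real.rpow_one]
      apply Real.exp_le_exp.2
      have h1 := le_abs_self a
      have h2 : -a * w.re ≤ |a| * ‖w‖ := by
        calc -a * w.re ≤ |(-a) * w.re| := le_abs_self _
          _ = |a| * |w.re| := by rw [abs_mul, abs_neg]
          _ ≤ _ := by gcongr; exact Complex.abs_re_le_norm w
      nlinarith [norm_nonneg w]
    · refine ⟨1, ?_⟩
      have h1 : Tendsto (fun x : ℝ => (x : ℂ)) atTop (Bornology.cobounded ℂ) := by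
        rw [← tendsto_norm_atTop_iff_cobounded]
        simpa using tendsto_abs_atTop_atTop
      rw [eventually_map]
      filter_upwards [h1.eventually hev, eventually_ge_atTop 0] with x hx hx0
      refine hx.trans (le_of_eq ?_)
      rw [← Real.exp_add]
      simp [abs_of_nonneg hx0]
    · intro x
      rw [hnorm]
      have : Complex.I * ((x : ℂ) * Complex.I) = ((-x : ℝ) : ℂ) := by
        push_cast
        linear_combination (x : ℂ) * Complex.I_mul_I
      rw [this]
      simpa using hC (-x)
  rw [hnorm] at key
  have h2 : Complex.I * (-Complex.I * z) = z := by
    linear_combination (-z) * Complex.I_mul_I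
  rw [h2] at key
  have h3 : (-Complex.I * z).re = z.im := by simp
  rw [h3] at key
  calc ‖F z‖ = ‖F z‖ * Real.exp (-a * z.im) * Real.exp (a * z.im) := by
        rw [mul_assoc, ← Real.exp_add]; simp
    _ ≤ _ := by gcongr

/-- Phragmén–Lindelöf: an entire function of exponential type at most `τ` that is bounded by `C` on
the real line is bounded by `C exp (τ |y|)` at `x + iy`. -/
lemma norm_le_exp_abs_im {F : ℂ → ℂ} (hF : Differentiable ℂ F) {τ C : ℝ}
    (hexp : exponentialType F ≤ (τ : EReal)) (hC : ∀ x : ℝ, ‖F x‖ ≤ C) (z : ℂ) :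
    ‖F z‖ ≤ C * Real.exp (τ * |z.im|) := by
  have h1 : ∀ ε > 0, ‖F z‖ ≤ C * Real.exp ((τ + ε) * |z.im|) := by
    intro ε hε
    have hev := eventually_norm_le_exp_of_exponentialType_le hexp hε
    rcases le_total 0 z.im with h | h
    · rw [abs_of_nonneg h]
      exact norm_le_exp_im_of_im_nonneg hF hev hC h
    · have hneg : Tendsto (fun w : ℂ => -w) (Bornology.cobounded ℂ) (Bornology.cobounded ℂ) := by
        rw [← tendsto_norm_atTop_iff_cobounded]
        simpa using tendsto_norm_cobounded_atTop
      have := norm_le_exp_im_of_im_nonneg (F := fun w => F (-w)) (z := -z) (a := τ + ε) (C := C)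
        (hF.comp differentiable_neg) (by simpa using hneg.eventually hev)
        (fun x => by simpa using hC (-x)) (by simpa using h)
      simpa [abs_of_nonpos h] using this
  have h2 : Tendsto (fun ε : ℝ => C * Real.exp ((τ + ε) * |z.im|)) (nhdsWithin 0 (Ioi 0))
      (nhds (C * Real.exp ((τ + 0) * |z.im|))) :=
    (Continuous.tendsto (by fun_prop) 0).mono_left nhdsWithin_le_nhds
  rw [add_zero] at h2
  exact ge_of_tendsto h2 (by filter_upwards [self_mem_nhdsWithin] with ε hε using h1 ε hε)

/-- Cauchy's estimate on unit circles. -/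
lemma norm_deriv_le_exp_abs_im {F : ℂ → ℂ} (hF : Differentiable ℂ F) {τ C : ℝ} (hτ : 0 ≤ τ)
    (hC : ∀ z, ‖F z‖ ≤ C * Real.exp (τ * |z.im|)) (z : ℂ) :
    ‖deriv F z‖ ≤ C * Real.exp τ * Real.exp (τ * |z.im|) := by
  have hC0 : 0 ≤ C := by simpa using (norm_nonneg _).trans (hC 0)
  have := Complex.norm_deriv_le_of_forall_mem_sphere_norm_le (c := z) (R := 1)
    (C := C * Real.exp τ * Real.exp (τ * |z.im|)) (f := F) one_pos hF.diffContOnCl ?_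
  · simpa using this
  · intro w hw
    refine (hC w).trans ?_
    rw [mul_assoc, ← Real.exp_add]
    gcongr
    have h1 : |w.im - z.im| ≤ 1 := by
      have := Complex.abs_im_le_norm (w - z)
      rw [mem_sphere_iff_norm] at hw
      simpa [hw] using this
    have h2 : |w.im| ≤ 1 + |z.im| := by
      have := abs_sub_abs_le_abs_sub w.im z.im
      linarith
    nlinarith

/-! ### Poisson summation for entire functions of type less than `2π` -/

lemma integrable_of_norm_le_inv_one_add_sq {f : ℝ → ℂ} (hc : Continuous f) {C : ℝ}
    (hC : ∀ x, ‖f x‖ ≤ C / (1 + x ^ 2)) : Integrable f := by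
  refine Integrable.mono' (integrable_inv_one_add_sq.const_mul C) hc.aestronglyMeasurable ?_
  exact Eventually.of_forall fun x => by simpa [div_eq_mul_inv] using hC x

/-- The integral over a horizontal line does not depend on the line if the function is
`O(1 / (1 + x²))`, uniformly in the strip. -/
lemma integral_horizontal_line_eq {k : ℂ → ℂ} (hk : Differentiable ℂ k) {C y : ℝ}
    (hC : ∀ x : ℝ, ∀ t ∈ uIcc 0 y, ‖k (x + t * Complex.I)‖ ≤ C / (1 + x ^ 2)) :
    ∫ x : ℝ, k x = ∫ x : ℝ, k (x + y * Complex.I) := by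
  have hint : ∀ t ∈ uIcc 0 y, Integrable fun x : ℝ => k (x + t * Complex.I) := fun t ht =>
    integrable_of_norm_le_inv_one_add_sq
      (hk.continuous.comp (by fun_prop)) (fun x => hC x t ht)
  have h0 := hint 0 left_mem_uIcc
  simp only [Complex.ofReal_zero, zero_mul, add_zero] at h0
  have h1 := hint y right_mem_uIcc
  have t0 := intervalIntegral_tendsto_integral h0 tendsto_neg_atTop_atBot tendsto_id
  have t1 := intervalIntegral_tendsto_integral h1 tendsto_neg_atTop_atBot tendsto_id
  have hzero : Tendsto (fun R : ℝ => C / (1 + R ^ 2) * |y - 0|) atTop (nhds 0) := by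
    have : Tendsto (fun R : ℝ => C / (1 + R ^ 2)) atTop (nhds 0) :=
      Tendsto.const_div_atTop
        (tendsto_atTop_add_const_left _ _ (tendsto_pow_atTop two_ne_zero)) C
    simpa using this.mul_const |y - 0|
  have v : ∀ s : ℝ → ℝ, (∀ R, s R ^ 2 = R ^ 2) → Tendsto (fun R : ℝ =>
      Complex.I • ∫ t : ℝ in (0 : ℝ)..y, k ((s R : ℂ) + t * Complex.I)) atTop (nhds 0) := by
    intro s hs
    refine squeeze_zero_norm (fun R => ?_) hzero
    rw [norm_smul, Complex.norm_I, one_mul]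
    refine intervalIntegral.norm_integral_le_of_norm_le_const fun t ht => ?_
    have := hC (s R) t (uIoc_subset_uIcc ht)
    rwa [hs] at this
  have hrect : ∀ R : ℝ, (∫ x : ℝ in -R..R, k x) - (∫ x : ℝ in -R..R, k (x + y * Complex.I)) +
      Complex.I • (∫ t : ℝ in (0 : ℝ)..y, k ((R : ℂ) + t * Complex.I)) -
      Complex.I • (∫ t : ℝ in (0 : ℝ)..y, k (((-R : ℝ) : ℂ) + t * Complex.I)) = 0 := by
    intro R
    have := Complex.integral_boundary_rect_eq_zero_of_differentiableOn k ((-R : ℝ) : ℂ)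
      ((R : ℂ) + y * Complex.I) hk.differentiableOn
    simpa using this
  have hlim := (((t0.sub t1).add (v id fun _ => rfl)).sub (v (fun R => -R) fun R => neg_sq R))
  have := tendsto_nhds_unique hlim (by
    refine tendsto_const_nhds.congr fun R => ?_
    exact (hrect R).symm)
  simpa [sub_eq_zero] using this

open FourierTransform in
/-- Moving the line of integration up or down to infinity shows that the Fourier transform vanishes
at non-zero integers. -/
lemma fourier_int_eq_zero {f : ℂ → ℂ} (hf : Differentiable ℂ f) {C τ : ℝ}
    (hτ : τ < 2 * Real.pi)
    (hC : ∀ z : ℂ, ‖f z‖ ≤ C * Real.exp (τ * |z.im|) / (1 + z.re ^ 2)) {n : ℤ} (hn : n ≠ 0) :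
    𝓕 (fun x : ℝ => f x) (n : ℝ) = 0 := by
  have hC0 : 0 ≤ C := by simpa using (norm_nonneg _).trans (hC 0)
  set k : ℂ → ℂ := fun z => Complex.exp (-2 * Real.pi * n * Complex.I * z) * f z with hkdef
  have hk : Differentiable ℂ k := Differentiable.mul (by fun_prop) hf
  have hF : 𝓕 (fun x : ℝ => f x) (n : ℝ) = ∫ x : ℝ, k x := by
    rw [Real.fourier_real_eq_integral_exp_smul]
    congr 1 with x
    simp only [hkdef, smul_eq_mul]
    congr 2
    push_cast
    ring
  have hknorm : ∀ x t : ℝ, ‖k (x + t * Complex.I)‖ ≤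
      C * Real.exp (2 * Real.pi * n * t + τ * |t|) / (1 + x ^ 2) := by
    intro x t
    rw [hkdef, norm_mul, Complex.norm_exp]
    have h1 : (-2 * Real.pi * n * Complex.I * ((x : ℂ) + t * Complex.I)).re
        = 2 * Real.pi * n * t := by
      simp
    rw [h1]
    have h2 := hC (x + t * Complex.I)
    simp only [Complex.add_im, Complex.ofReal_im, Complex.mul_im, Complex.ofReal_re, Complex.I_im,
      mul_one, Complex.I_re, mul_zero, add_zero, zero_add, Complex.add_re, Complex.mul_re,
      sub_self] at h2
    calc _ ≤ Real.exp (2 * Real.pi * n * t) * (C * Real.exp (τ * |t|) / (1 + x ^ 2)) := by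
          gcongr
      _ = _ := by rw [Real.exp_add]; ring
  -- the line of integration moves in the direction in which `exp (-2πinz)` decays
  obtain ⟨s, hs, hsn⟩ : ∃ s : ℝ, |s| = 1 ∧ (n : ℝ) * s ≤ -1 := by
    rcases lt_or_gt_of_ne hn with h | h
    · exact ⟨1, by simp, by rw [mul_one]; exact_mod_cast Int.le_sub_one_of_lt h⟩
    · refine ⟨-1, by simp, ?_⟩
      have : (1 : ℝ) ≤ n := by exact_mod_cast h
      linarith
  have hbound : ∀ Y : ℝ, 0 ≤ Y → ‖∫ x : ℝ, k x‖ ≤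
      C * Real.pi * Real.exp (-((2 * Real.pi - τ) * Y)) := by
    intro Y hY
    have hexp : ∀ r : ℝ, 0 ≤ r →
        2 * Real.pi * n * (s * r) + τ * |s * r| ≤ -((2 * Real.pi - τ) * r) := by
      intro r hr
      rw [abs_mul, hs, one_mul, abs_of_nonneg hr]
      nlinarith [mul_nonneg Real.pi_pos.le hr]
    rw [integral_horizontal_line_eq hk (C := C) (y := s * Y)]
    · refine (norm_integral_le_of_norm_le (g := fun x : ℝ =>
        C * Real.exp (-((2 * Real.pi - τ) * Y)) * (1 + x ^ 2)⁻¹)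
        (integrable_inv_one_add_sq.const_mul _) (Eventually.of_forall fun x => ?_)).trans ?_
      · refine (hknorm x _).trans ?_
        rw [div_eq_mul_inv]
        gcongr
        exact hexp Y hY
      · rw [integral_const_mul, integral_univ_inv_one_add_sq]
        exact le_of_eq (by ring)
    · intro x t ht
      obtain ⟨r, hr, rfl⟩ : ∃ r : ℝ, 0 ≤ r ∧ t = s * r := by
        have hss : s * s = 1 := by rw [← abs_mul_abs_self, hs, one_mul]
        refine ⟨s * t, ?_, by rw [← mul_assoc, hss, one_mul]⟩
        rcases (abs_eq one_pos.le).1 hs with rfl | rfl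
        · rw [one_mul, uIcc_of_le hY] at ht; simpa using ht.1
        · rw [uIcc_of_ge (by linarith)] at ht; simpa using ht.2
      refine (hknorm x _).trans ?_
      gcongr
      refine mul_le_of_le_one_right hC0 (Real.exp_le_one_iff.2 ((hexp r hr).trans ?_))
      have := mul_nonneg (sub_nonneg.2 hτ.le) hr
      linarith
  have hlim : Tendsto (fun Y : ℝ => C * Real.pi * Real.exp (-((2 * Real.pi - τ) * Y))) atTop
      (nhds (C * Real.pi * 0)) :=
    (Real.tendsto_exp_neg_atTop_nhds_zero.comp
      (tendsto_id.const_mul_atTop (sub_pos.2 hτ))).const_mul _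
  rw [mul_zero] at hlim
  rw [hF, ← norm_le_zero_iff]
  exact ge_of_tendsto hlim (by filter_upwards [eventually_ge_atTop 0] with Y hY using hbound Y hY)

lemma summable_int_inv_one_add_sq : Summable fun n : ℤ => (1 + (n : ℝ) ^ 2)⁻¹ := by
  refine Summable.of_nonneg_of_le (fun n => by positivity) (fun n => ?_)
    ((Real.summable_one_div_int_pow.2 one_lt_two).add
      (summable_of_hasFiniteSupport (f := fun n : ℤ => if n = 0 then (1 : ℝ) else 0)
        ((finite_singleton (0 : ℤ)).subset fun n hn => by
          by_contra h
          exact hn (if_neg h))))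
  rcases eq_or_ne n 0 with rfl | hn
  · simp
  · have : (0 : ℝ) < (n : ℝ) ^ 2 := by positivity
    rw [if_neg hn, add_zero, one_div]
    gcongr
    linarith

open FourierTransform in
/-- Poisson summation for an entire function of type less than `2π`: only the zeroth Fourier
coefficient survives. -/
lemma hasSum_int_of_type_lt {f : ℂ → ℂ} (hf : Differentiable ℂ f) {C τ : ℝ}
    (hτ : τ < 2 * Real.pi)
    (hC : ∀ z : ℂ, ‖f z‖ ≤ C * Real.exp (τ * |z.im|) / (1 + z.re ^ 2)) :
    HasSum (fun n : ℤ => f n) (∫ x : ℝ, f x) := by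
  have hC0 : 0 ≤ C := by simpa using (norm_nonneg _).trans (hC 0)
  have hCr : ∀ x : ℝ, ‖f x‖ ≤ C / (1 + x ^ 2) := fun x => by simpa using hC x
  have hc : Continuous fun x : ℝ => f x := hf.continuous.comp Complex.continuous_ofReal
  have hfour : ∀ n : ℤ, n ≠ 0 → 𝓕 (fun x : ℝ => f x) (n : ℝ) = 0 := fun n hn =>
    fourier_int_eq_zero hf hτ hC hn
  have hsum : Summable fun n : ℤ => f n := by
    refine Summable.of_norm_bounded (summable_int_inv_one_add_sq.mul_left C) fun n => ?_
    simpa [div_eq_mul_inv] using hCr n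
  have hbig : (fun x : ℝ => f x) =O[cocompact ℝ] fun x : ℝ => |x| ^ (-2 : ℝ) := by
    refine Asymptotics.IsBigO.of_bound C ?_
    have h0 : ∀ᶠ x : ℝ in cocompact ℝ, x ≠ 0 := by
      have := (isCompact_singleton (x := (0 : ℝ))).compl_mem_cocompact
      filter_upwards [this] with x hx using hx
    filter_upwards [h0] with x hx
    refine (hCr x).trans ?_
    have hx2 : 0 < x ^ 2 := by positivity
    rw [Real.norm_of_nonneg (by positivity), Real.rpow_neg (abs_nonneg x), Real.rpow_two, sq_abs,
      div_eq_mul_inv]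
    gcongr
    linarith
  have hP := Real.tsum_eq_tsum_fourier_of_rpow_decay_of_summable hc one_lt_two hbig
    (summable_of_ne_finset_zero (s := {0}) fun n hn => hfour n (by simpa using hn)) 0
  have hR : ∑' n : ℤ, 𝓕 (fun x : ℝ => f x) n * fourier n ((0 : ℝ) : UnitAddCircle) =
      𝓕 (fun x : ℝ => f x) ((0 : ℤ) : ℝ) * fourier 0 ((0 : ℝ) : UnitAddCircle) :=
    tsum_eq_single (0 : ℤ) fun n hn => by rw [hfour n hn, zero_mul]
  have h0 : 𝓕 (fun x : ℝ => f x) ((0 : ℤ) : ℝ) = ∫ x : ℝ, f x := by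
    rw [Real.fourier_real_eq_integral_exp_smul]
    simp
  rw [hR, h0] at hP
  simp only [zero_add, Complex.ofReal_intCast, fourier_zero, mul_one] at hP
  exact hP ▸ hsum.hasSum

/-- Sampling with step `δ` an entire function of type `τ` with `δ τ < 2π`. -/
lemma hasSum_int_smul {f : ℂ → ℂ} (hf : Differentiable ℂ f) {C τ δ : ℝ}
    (hδ : 0 < δ) (hδ1 : δ ≤ 1) (hτ : τ * δ < 2 * Real.pi)
    (hC : ∀ z : ℂ, ‖f z‖ ≤ C * Real.exp (τ * |z.im|) / (1 + z.re ^ 2)) :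
    HasSum (fun n : ℤ => (δ : ℂ) * f (δ * n)) (∫ x : ℝ, f x) := by
  have hC0 : 0 ≤ C := by simpa using (norm_nonneg _).trans (hC 0)
  have h := hasSum_int_of_type_lt (f := fun z => f (δ * z)) (C := C / δ ^ 2) (τ := τ * δ)
    (hf.comp (by fun_prop)) hτ (fun z => by
      refine (hC _).trans ?_
      have him : ((δ : ℂ) * z).im = δ * z.im := by simp
      have hre : ((δ : ℂ) * z).re = δ * z.re := by simp
      rw [him, hre, abs_mul, abs_of_pos hδ, div_mul_eq_mul_div, div_div, mul_assoc]
      gcongr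
      nlinarith [sq_nonneg z.re, mul_pow δ z.re 2])
  have hint : ∫ x : ℝ, f (δ * (x : ℂ)) = (δ : ℂ)⁻¹ * ∫ x : ℝ, f x := by
    have := Measure.integral_comp_mul_left (fun x : ℝ => f x) δ
    rw [abs_of_pos (inv_pos.2 hδ)] at this
    simpa using this
  rw [hint] at h
  have hδc : (δ : ℂ) ≠ 0 := by exact_mod_cast hδ.ne'
  simpa [mul_inv_cancel_left₀ hδc] using h.mul_left (δ : ℂ)

/-- The endpoint case of type exactly `2π`, obtained by sampling with step `δ → 1`. -/
lemma tsum_int_eq_integral {f : ℂ → ℂ} (hf : Differentiable ℂ f) {C : ℝ}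
    (hC : ∀ z : ℂ, ‖f z‖ ≤ C * Real.exp (2 * Real.pi * |z.im|) / (1 + z.re ^ 2)) :
    ∑' n : ℤ, f n = ∫ x : ℝ, f x := by
  have hC0 : 0 ≤ C := by simpa using (norm_nonneg _).trans (hC 0)
  have hδ : ∀ᶠ δ : ℝ in nhdsWithin 1 (Iio 1), 1 / 2 < δ ∧ δ < 1 :=
    Ioo_mem_nhdsLT (by norm_num)
  have hlim : Tendsto (fun δ : ℝ => ∑' n : ℤ, (δ : ℂ) * f (δ * n)) (nhdsWithin 1 (Iio 1))
      (nhds (∑' n : ℤ, f n)) := by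
    refine tendsto_tsum_of_dominated_convergence
      (bound := fun n : ℤ => 4 * C * (1 + (n : ℝ) ^ 2)⁻¹)
      (summable_int_inv_one_add_sq.mul_left _) (fun n => ?_) ?_
    · have hcont : Continuous fun δ : ℝ => (δ : ℂ) * f (δ * n) := by
        have := hf.continuous
        fun_prop
      have := hcont.tendsto 1
      simp only [Complex.ofReal_one, one_mul] at this
      exact this.mono_left nhdsWithin_le_nhds
    · filter_upwards [hδ] with δ hδ n
      have h1 := hC (δ * n)
      have him : ((δ : ℂ) * n).im = 0 := by simp
      have hre : ((δ : ℂ) * n).re = δ * n := by simp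
      rw [him, hre, abs_zero, mul_zero, Real.exp_zero, mul_one] at h1
      rw [norm_mul, Complex.norm_real, Real.norm_of_nonneg (by linarith)]
      calc δ * ‖f (δ * n)‖ ≤ 1 * (C / (1 + (δ * n) ^ 2)) := by
            gcongr
            exact hδ.2.le
        _ ≤ C / ((1 + (n : ℝ) ^ 2) / 4) := by
            rw [one_mul]
            have h2 : 1 / 4 ≤ δ ^ 2 := by nlinarith
            gcongr
            rw [mul_pow]
            nlinarith [sq_nonneg (n : ℝ)]
        _ = _ := by field_simp
  refine tendsto_nhds_unique hlim (tendsto_const_nhds.congr' ?_)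
  filter_upwards [hδ] with δ hδ
  exact (hasSum_int_smul hf (by linarith) hδ.2.le (by nlinarith [Real.pi_pos]) hC).tsum_eq.symm

/-! ### The normalized sinc function and the Fejér kernel -/

/-- The entire function `sin (π z) / (π z)`, with value `1` at the origin. It is encoded as a
difference quotient, so that it is entire by the removable singularity theorem. -/
noncomputable def sincPi (z : ℂ) : ℂ :=
  dslope (fun w : ℂ => Complex.sin (Real.pi * w) / Real.pi) 0 z

lemma pi_mul_mul_sincPi (z : ℂ) : Real.pi * z * sincPi z = Complex.sin (Real.pi * z) := by
  have h := sub_smul_dslope (fun w : ℂ => Complex.sin (Real.pi * w) / Real.pi) 0 z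
  have hpi : (Real.pi : ℂ) ≠ 0 := by exact_mod_cast Real.pi_ne_zero
  simp only [sub_zero, smul_eq_mul, mul_zero, Complex.sin_zero, zero_div] at h
  rw [sincPi, mul_assoc, h, mul_div_cancel₀ _ hpi]

lemma sincPi_zero : sincPi 0 = 1 := by
  have hpi : (Real.pi : ℂ) ≠ 0 := by exact_mod_cast Real.pi_ne_zero
  rw [sincPi, dslope_same]
  have h : HasDerivAt (fun w : ℂ => Complex.sin (Real.pi * w) / Real.pi)
      (Complex.cos (Real.pi * 0) * (Real.pi * 1) / Real.pi) 0 :=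
    (((hasDerivAt_id (0 : ℂ)).const_mul (Real.pi : ℂ)).csin).div_const _
  rw [h.deriv]
  simp [hpi]

lemma differentiable_sincPi : Differentiable ℂ sincPi := by
  rw [← differentiableOn_univ]
  exact (Complex.differentiableOn_dslope univ_mem).2
    (Differentiable.differentiableOn (by fun_prop))

lemma sincPi_int {n : ℤ} (hn : n ≠ 0) : sincPi n = 0 := by
  have h := pi_mul_mul_sincPi n
  have hpi : (Real.pi : ℂ) ≠ 0 := by exact_mod_cast Real.pi_ne_zero
  have hn' : (n : ℂ) ≠ 0 := by exact_mod_cast hn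
  rw [mul_comm (Real.pi : ℂ) n, Complex.sin_int_mul_pi] at h
  simpa [hpi, hn'] using h

lemma sincPi_ofReal_im (x : ℝ) : (sincPi x).im = 0 := by
  rcases eq_or_ne x 0 with rfl | hx
  · simp [sincPi_zero]
  · have h := congrArg Complex.im (pi_mul_mul_sincPi x)
    rw [← Complex.ofReal_mul, ← Complex.ofReal_sin, Complex.ofReal_im, Complex.im_ofReal_mul] at h
    simpa [hx, Real.pi_ne_zero] using h

lemma ofReal_re_sincPi (x : ℝ) : ((sincPi x).re : ℂ) = sincPi x :=
  Complex.ext rfl (by simp [sincPi_ofReal_im])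

lemma norm_sin_le_exp_abs_im (z : ℂ) : ‖Complex.sin z‖ ≤ Real.exp |z.im| := by
  rw [Complex.sin, norm_div, norm_mul, Complex.norm_I, mul_one, Complex.norm_ofNat]
  have h1 := norm_sub_le (Complex.exp (-z * Complex.I)) (Complex.exp (z * Complex.I))
  rw [Complex.norm_exp, Complex.norm_exp] at h1
  have h2 : Real.exp (-z * Complex.I).re ≤ Real.exp |z.im| :=
    Real.exp_le_exp.2 (by simpa using le_abs_self z.im)
  have h3 : Real.exp (z * Complex.I).re ≤ Real.exp |z.im| :=
    Real.exp_le_exp.2 (by simpa using neg_le_abs z.im)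
  linarith

lemma exists_norm_sincPi_le :
    ∃ C : ℝ, 0 < C ∧ ∀ z : ℂ, ‖sincPi z‖ ≤ C * Real.exp (Real.pi * |z.im|) / (1 + ‖z‖) := by
  obtain ⟨A, hA⟩ := (isCompact_closedBall (0 : ℂ) 1).exists_bound_of_continuousOn
    differentiable_sincPi.continuous.continuousOn
  have hA0 : 0 ≤ A := (norm_nonneg _).trans (hA 0 (by simp))
  refine ⟨2 * A + 2, by positivity, fun z => ?_⟩
  have hz := norm_nonneg z
  have he : 1 ≤ Real.exp (Real.pi * |z.im|) := Real.one_le_exp (by positivity)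
  rw [le_div_iff₀ (by positivity)]
  rcases le_total ‖z‖ 1 with h | h
  · have := hA z (by simpa using h)
    calc ‖sincPi z‖ * (1 + ‖z‖) ≤ A * 2 := by gcongr; linarith
      _ ≤ (2 * A + 2) * 1 := by linarith
      _ ≤ _ := by gcongr
  · have h1 := congrArg norm (pi_mul_mul_sincPi z)
    rw [norm_mul, norm_mul, Complex.norm_real, Real.norm_of_nonneg Real.pi_pos.le] at h1
    have h2 := norm_sin_le_exp_abs_im (Real.pi * z)
    rw [← h1, Complex.im_ofReal_mul, abs_mul, abs_of_pos Real.pi_pos] at h2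
    have h3 : ‖sincPi z‖ * (1 + ‖z‖) ≤ 2 * (Real.pi * ‖z‖ * ‖sincPi z‖) := by
      have h4 := Real.pi_gt_three
      have h5 := norm_nonneg (sincPi z)
      have h6 : 0 ≤ ‖z‖ * ‖sincPi z‖ := by positivity
      nlinarith [mul_le_mul_of_nonneg_right h h5]
    nlinarith

/-- The entire extension of `extremalKernel`: since `(z + 1) s(z + 1) = -z s(z)` for the normalized
sinc function `s`, one has `s(z + 1) = -z (s(z) + s(z + 1))`, which removes the pole at `0` of
`s(z + 1)² / z`. -/
noncomputable def entireKernel (z : ℂ) : ℂ := -(sincPi (z + 1) * (sincPi z + sincPi (z + 1)))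

lemma add_one_mul_sincPi (z : ℂ) : (z + 1) * sincPi (z + 1) = -(z * sincPi z) := by
  have hpi : (Real.pi : ℂ) ≠ 0 := by exact_mod_cast Real.pi_ne_zero
  have h1 := pi_mul_mul_sincPi z
  have h2 := pi_mul_mul_sincPi (z + 1)
  rw [mul_add, mul_one, Complex.sin_add_pi, ← h1] at h2
  apply mul_left_cancel₀ hpi
  linear_combination h2

lemma mul_entireKernel (z : ℂ) : z * entireKernel z = sincPi (z + 1) ^ 2 := by
  rw [entireKernel]
  linear_combination (-sincPi (z + 1)) * add_one_mul_sincPi z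

lemma pi_sq_mul_entireKernel (z : ℂ) :
    (Real.pi : ℂ) ^ 2 * (z * (z + 1) ^ 2 * entireKernel z) = Complex.sin (Real.pi * z) ^ 2 := by
  rw [← pi_mul_mul_sincPi]
  linear_combination ((Real.pi : ℂ) ^ 2 * (z + 1) ^ 2) * mul_entireKernel z +
    (Real.pi : ℂ) ^ 2 * ((z + 1) * sincPi (z + 1) - z * sincPi z) * add_one_mul_sincPi z

lemma extremalKernel_eq {z : ℂ} (h0 : z ≠ 0) (h1 : z ≠ -1) :
    extremalKernel z = entireKernel z := by
  have hpi : (Real.pi : ℂ) ≠ 0 := by exact_mod_cast Real.pi_ne_zero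
  have h1' : z + 1 ≠ 0 := fun h => h1 (eq_neg_of_add_eq_zero_left h)
  rw [extremalKernel, ← pi_sq_mul_entireKernel]
  field_simp

lemma differentiable_entireKernel : Differentiable ℂ entireKernel := by
  have := differentiable_sincPi
  unfold entireKernel
  fun_prop

lemma sincPi_add_one_norm_le {C : ℝ} (hC0 : 0 < C)
    (hC : ∀ z : ℂ, ‖sincPi z‖ ≤ C * Real.exp (Real.pi * |z.im|) / (1 + ‖z‖)) (z : ℂ) :
    ‖sincPi (z + 1)‖ ≤ 2 * C * Real.exp (Real.pi * |z.im|) / (1 + ‖z‖) := by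
  have h := hC (z + 1)
  rw [Complex.add_im, Complex.one_im, add_zero] at h
  refine h.trans ?_
  rw [div_le_div_iff₀ (by positivity) (by positivity)]
  have h1 : 1 + ‖z‖ ≤ 2 * (1 + ‖z + 1‖) := by
    have h2 : ‖z‖ ≤ ‖z + 1‖ + 1 := by simpa using norm_sub_le (z + 1) 1
    linarith [norm_nonneg (z + 1)]
  nlinarith [mul_pos hC0 (Real.exp_pos (Real.pi * |z.im|))]

lemma exp_div_sq_le {A t : ℝ} (hA : 0 ≤ A) (z : ℂ) :
    A * Real.exp (t * |z.im|) / (1 + ‖z‖) ^ 2 ≤ A * Real.exp (t * |z.im|) / (1 + z.re ^ 2) := by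
  gcongr
  have := Complex.abs_re_le_norm z
  nlinarith [sq_abs z.re, abs_nonneg z.re]

lemma exists_norm_entireKernel_le : ∃ C : ℝ, ∀ z : ℂ,
    ‖entireKernel z‖ ≤ C * Real.exp (2 * Real.pi * |z.im|) / (1 + z.re ^ 2) := by
  obtain ⟨C, hC0, hC⟩ := exists_norm_sincPi_le
  refine ⟨6 * C ^ 2, fun z => le_trans ?_ (exp_div_sq_le (by positivity) z)⟩
  have h1 := sincPi_add_one_norm_le hC0 hC z
  rw [entireKernel, norm_neg, norm_mul]
  calc _ ≤ (2 * C * Real.exp (Real.pi * |z.im|) / (1 + ‖z‖)) *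
        (C * Real.exp (Real.pi * |z.im|) / (1 + ‖z‖) +
          2 * C * Real.exp (Real.pi * |z.im|) / (1 + ‖z‖)) := by
        gcongr
        exact (norm_add_le _ _).trans (add_le_add (hC z) h1)
    _ = _ := by
        rw [show 2 * Real.pi * |z.im| = Real.pi * |z.im| + Real.pi * |z.im| by ring, Real.exp_add]
        field_simp
        ring

lemma integrable_entireKernel : Integrable fun x : ℝ => entireKernel x := by
  obtain ⟨C, hC⟩ := exists_norm_entireKernel_le
  exact integrable_of_norm_le_inv_one_add_sq
    (differentiable_entireKernel.continuous.comp Complex.continuous_ofReal)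
    fun x => by simpa using hC x

/-- Poisson summation: among the integers only `-1` contributes. -/
lemma integral_entireKernel : ∫ x : ℝ, entireKernel x = -1 := by
  obtain ⟨C, hC⟩ := exists_norm_entireKernel_le
  rw [← tsum_int_eq_integral differentiable_entireKernel hC, tsum_eq_single (-1)]
  · have h := sincPi_int (n := -1) (by norm_num)
    push_cast at h
    simp [entireKernel, sincPi_zero, h]
  · intro n hn
    have h := sincPi_int (n := n + 1) (fun h => hn (by omega))
    push_cast at h
    simp [entireKernel, h]

lemma exists_norm_sincPi_sq_le : ∃ C : ℝ, ∀ z : ℂ,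
    ‖sincPi z ^ 2‖ ≤ C * Real.exp (2 * Real.pi * |z.im|) / (1 + z.re ^ 2) := by
  obtain ⟨C, hC0, hC⟩ := exists_norm_sincPi_le
  refine ⟨C ^ 2, fun z => le_trans ?_ (exp_div_sq_le (by positivity) z)⟩
  rw [norm_pow]
  calc _ ≤ (C * Real.exp (Real.pi * |z.im|) / (1 + ‖z‖)) ^ 2 := by
        gcongr
        exact hC z
    _ = _ := by
        rw [show 2 * Real.pi * |z.im| = Real.pi * |z.im| + Real.pi * |z.im| by ring, Real.exp_add]
        field_simp

lemma integrable_sincPi_sq : Integrable fun x : ℝ => sincPi x ^ 2 := by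
  obtain ⟨C, hC⟩ := exists_norm_sincPi_sq_le
  exact integrable_of_norm_le_inv_one_add_sq
    ((differentiable_sincPi.continuous.comp Complex.continuous_ofReal).pow 2)
    fun x => by simpa using hC x

lemma integral_sincPi_sq : ∫ x : ℝ, sincPi x ^ 2 = 1 := by
  obtain ⟨C, hC⟩ := exists_norm_sincPi_sq_le
  have h := tsum_int_eq_integral (f := fun z => sincPi z ^ 2) (differentiable_sincPi.pow 2) hC
  rw [← h, tsum_eq_single 0]
  · simp [sincPi_zero]
  · intro n hn
    simp [sincPi_int hn]

/-! ### Integration by parts for the excess over the limit -/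

lemma tendsto_of_antitoneOn_of_lintegral_ne_top {g : ℝ → ℝ} {L : ℝ} (hg : AntitoneOn g (Ioi 0))
    (hL : ∀ x > 0, L ≤ g x) (hfin : ∫⁻ x in Ioi (0 : ℝ), ENNReal.ofReal (g x - L) ≠ ⊤) :
    Tendsto g atTop (nhds L) := by
  refine tendsto_order.2 ⟨fun a ha => ?_, fun b hb => ?_⟩
  · filter_upwards [eventually_gt_atTop 0] with x hx using ha.trans_le (hL x hx)
  · obtain ⟨x, hx, hxb⟩ : ∃ x > 0, g x < b := by
      by_contra! h
      refine hfin (top_le_iff.1 ?_)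
      calc (⊤ : ENNReal) = ∫⁻ _ in Ioi (0 : ℝ), ENNReal.ofReal (b - L) := by
            rw [setLIntegral_const, Real.volume_Ioi, ENNReal.mul_top]
            simpa using hb
        _ ≤ _ := by
            refine setLIntegral_mono' measurableSet_Ioi fun x hx => ?_
            gcongr
            exact h x hx
    filter_upwards [eventually_ge_atTop x] with y hy
    exact (hg hx (lt_of_lt_of_le hx hy) hy).trans_lt hxb

/-- Layer-cake form of integration by parts, valid also if both sides are infinite. -/
lemma lintegral_sub_limit_eq {g g' : ℝ → ℝ} {L : ℝ} (hg : ∀ x, HasDerivAt g (g' x) x)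
    (hc : Continuous g') (hneg : ∀ x > 0, g' x ≤ 0) (hlim : Tendsto g atTop (nhds L)) :
    ∫⁻ x in Ioi (0 : ℝ), ENNReal.ofReal (g x - L) =
      ∫⁻ x in Ioi (0 : ℝ), ENNReal.ofReal (-x * g' x) := by
  set w : ℝ → ENNReal := fun t => ENNReal.ofReal (-g' t) with hw
  have hwm : Measurable w := hc.neg.measurable.ennreal_ofReal
  set μ : Measure ℝ := (volume.restrict (Ioi 0)).withDensity w with hμ
  have hpos : ∀ᵐ a ∂μ, (0 : ℝ) ≤ a := by
    refine (withDensity_absolutelyContinuous _ _).ae_le ?_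
    filter_upwards [ae_restrict_mem measurableSet_Ioi] with a ha using le_of_lt ha
  have hcake := lintegral_eq_lintegral_meas_le μ (f := fun a : ℝ => a) hpos aemeasurable_id
  have htail : ∀ x ∈ Ioi (0 : ℝ), μ {a | x ≤ a} = ENNReal.ofReal (g x - L) := by
    intro x hx
    rw [show {a : ℝ | x ≤ a} = Ici x from rfl, hμ, withDensity_apply _ measurableSet_Ici,
      Measure.restrict_restrict measurableSet_Ici,
      inter_eq_left.2 (show Ici x ⊆ Ioi 0 from Ici_subset_Ioi.2 hx),
      setLIntegral_congr Ioi_ae_eq_Ici.symm]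
    have hnp : ∀ y ∈ Ioi x, g' y ≤ 0 := fun y hy => hneg y (lt_trans hx hy)
    have hint := integrableOn_Ioi_deriv_of_nonpos' (fun y _ => hg y) hnp hlim
    have hE := ofReal_integral_eq_lintegral_ofReal hint.neg (by
      filter_upwards [ae_restrict_mem measurableSet_Ioi] with a ha
      simpa using hnp a ha)
    rw [show ∫⁻ t in Ioi x, w t = ENNReal.ofReal (∫ t in Ioi x, -g' t) from hE.symm,
      integral_neg,
      integral_Ioi_of_hasDerivAt_of_nonpos' (fun y _ => hg y) hnp hlim, neg_sub]
  rw [← setLIntegral_congr_fun measurableSet_Ioi htail, ← hcake, hμ,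
    lintegral_withDensity_eq_lintegral_mul _ hwm ENNReal.measurable_ofReal]
  refine setLIntegral_congr_fun measurableSet_Ioi fun x hx => ?_
  simp only [Pi.mul_apply, hw]
  rw [← ENNReal.ofReal_mul (by simpa using hneg x hx)]
  congr 1
  ring

lemma lintegral_eq_Ioi_add_Ioi_neg (f : ℝ → ENNReal) :
    ∫⁻ x, f x = (∫⁻ x in Ioi 0, f x) + ∫⁻ x in Ioi 0, f (-x) := by
  rw [← lintegral_add_compl f measurableSet_Ioi (A := Ioi (0 : ℝ)), compl_Ioi,
    setLIntegral_congr Iio_ae_eq_Iic.symm]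
  congr 1
  have h := (Measure.measurePreserving_neg (volume : Measure ℝ)).setLIntegral_comp_preimage_emb
    (MeasurableEquiv.neg ℝ).measurableEmbedding f (Iio 0)
  rw [← h]
  simp

/-- The excess over the signum function as the integral of `-x u'(x)`, from
`lintegral_sub_limit_eq` on either half-line. -/
lemma lintegral_sub_sign_eq {u u' : ℝ → ℝ} (hu : ∀ x, HasDerivAt u (u' x) x)
    (hc : Continuous u') (hneg : ∀ x > 0, u' x ≤ 0) (hpos : ∀ x < 0, 0 ≤ u' x)
    (htop : Tendsto u atTop (nhds 1)) (hbot : Tendsto u atBot (nhds (-1))) :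
    ∫⁻ x, ENNReal.ofReal (u x - Real.sign x) = ∫⁻ x, ENNReal.ofReal (-x * u' x) := by
  rw [lintegral_eq_Ioi_add_Ioi_neg, lintegral_eq_Ioi_add_Ioi_neg
    (fun x => ENNReal.ofReal (-x * u' x)), ← lintegral_sub_limit_eq hu hc hneg htop]
  have h2 := lintegral_sub_limit_eq (g := fun x => u (-x)) (g' := fun x => -u' (-x)) (L := -1)
    (fun x => by simpa [Function.comp_def] using (hu (-x)).scomp x (hasDerivAt_neg x)) (by fun_prop)
    (fun x hx => by simpa using hpos (-x) (by linarith)) (hbot.comp tendsto_neg_atTop_atBot)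
  congr 1
  · refine setLIntegral_congr_fun measurableSet_Ioi fun x hx => ?_
    rw [Real.sign_of_pos hx]
  · calc _ = ∫⁻ x in Ioi (0 : ℝ), ENNReal.ofReal (u (-x) - -1) := by
          refine setLIntegral_congr_fun measurableSet_Ioi fun x hx => ?_
          rw [Real.sign_of_neg (by simpa using hx)]
      _ = _ := h2
      _ = _ := by simp

lemma hasDerivAt_re_ofReal {F : ℂ → ℂ} (hF : Differentiable ℂ F) (x : ℝ) :
    HasDerivAt (fun x : ℝ => (F x).re) (deriv F x).re x :=
  (hF x).hasDerivAt.real_of_complex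

lemma IsRealEntire.ofReal_re {F : ℂ → ℂ} (hF : IsRealEntire F) (x : ℝ) : ((F x).re : ℂ) = F x :=
  Complex.ext rfl (by simp [hF.im_eq_zero x])

lemma IsRealEntire.deriv {F : ℂ → ℂ} (hF : IsRealEntire F) : IsRealEntire (deriv F) where
  differentiable := by
    have := hF.differentiable.differentiableOn (s := univ)
    exact differentiableOn_univ.1 (this.deriv isOpen_univ)
  im_eq_zero x := by
    have h1 : HasDerivAt (fun y : ℝ => F y) (_root_.deriv F x) x :=
      (hF.differentiable x).hasDerivAt.comp_ofReal
    have h2 := (hasDerivAt_re_ofReal hF.differentiable x).ofReal_comp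
    simp only [hF.ofReal_re] at h2
    rw [h1.unique h2, Complex.ofReal_im]

namespace IsMonotoneSignMajorant

variable {F : ℂ → ℂ}

lemma hasDerivAt_re (hF : IsMonotoneSignMajorant F) (x : ℝ) :
    HasDerivAt (fun x : ℝ => (F x).re) (deriv F x).re x :=
  hasDerivAt_re_ofReal hF.realEntire.differentiable x

lemma continuous_re_deriv (hF : IsMonotoneSignMajorant F) :
    Continuous fun x : ℝ => (deriv F x).re :=
  Complex.continuous_re.comp
    (hF.realEntire.deriv.differentiable.continuous.comp Complex.continuous_ofReal)

lemma re_deriv_nonpos (hF : IsMonotoneSignMajorant F) {x : ℝ} (hx : 0 ≤ x) :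
    (deriv F x).re ≤ 0 := by
  have hpos : ∀ y > 0, (deriv F (y : ℝ)).re ≤ 0 := fun y hy => by
    rw [← (hF.hasDerivAt_re y).deriv, ← derivWithin_of_mem_nhds (Ioi_mem_nhds hy)]
    exact hF.antitoneOn.derivWithin_nonpos
  rcases hx.eq_or_lt with rfl | hx
  · exact le_of_tendsto (hF.continuous_re_deriv.continuousWithinAt (s := Ioi 0))
      (by filter_upwards [self_mem_nhdsWithin] with y hy using hpos y hy)
  · exact hpos x hx

lemma re_deriv_nonneg (hF : IsMonotoneSignMajorant F) {x : ℝ} (hx : x ≤ 0) :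
    0 ≤ (deriv F x).re := by
  have hneg : ∀ y < 0, 0 ≤ (deriv F (y : ℝ)).re := fun y hy => by
    rw [← (hF.hasDerivAt_re y).deriv, ← derivWithin_of_mem_nhds (Iio_mem_nhds hy)]
    exact hF.monotoneOn.derivWithin_nonneg
  rcases hx.eq_or_lt with rfl | hx
  · exact ge_of_tendsto (hF.continuous_re_deriv.continuousWithinAt (s := Iio 0))
      (by filter_upwards [self_mem_nhdsWithin] with y hy using hneg y hy)
  · exact hneg x hx

lemma re_le_re_zero (hF : IsMonotoneSignMajorant F) (x : ℝ) : (F x).re ≤ (F 0).re := by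
  have hc : Continuous fun x : ℝ => (F x).re :=
    continuous_iff_continuousAt.2 fun x => (hF.hasDerivAt_re x).continuousAt
  have h := hF.hasDerivAt_re
  rcases le_total 0 x with hx | hx
  · have := antitoneOn_of_deriv_nonpos (convex_Ici 0) hc.continuousOn
      (fun y _ => (h y).differentiableAt.differentiableWithinAt) (fun y hy => by
        rw [(h y).deriv]
        exact hF.re_deriv_nonpos (interior_subset (s := Ici (0 : ℝ)) hy))
    simpa using this self_mem_Ici hx hx
  · have := monotoneOn_of_deriv_nonneg (convex_Iic 0) hc.continuousOn
      (fun y _ => (h y).differentiableAt.differentiableWithinAt) (fun y hy => by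
        rw [(h y).deriv]
        exact hF.re_deriv_nonneg (interior_subset (s := Iic (0 : ℝ)) hy))
    simpa using this hx self_mem_Iic hx

lemma exists_norm_deriv_le (hF : IsMonotoneSignMajorant F) :
    ∃ C : ℝ, 0 ≤ C ∧ ∀ z : ℂ, ‖deriv F z‖ ≤ C * Real.exp (2 * Real.pi * |z.im|) := by
  have hb : ∀ x : ℝ, ‖F x‖ ≤ max 1 (F 0).re := by
    intro x
    rw [← hF.realEntire.ofReal_re, Complex.norm_real, Real.norm_eq_abs, abs_le]
    refine ⟨?_, (hF.re_le_re_zero x).trans (le_max_right _ _)⟩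
    have h1 : -1 ≤ Real.sign x := by
      rcases Real.sign_apply_eq x with h | h | h <;> rw [h] <;> norm_num
    linarith [hF.sign_le x, le_max_left 1 (F 0).re]
  refine ⟨_, ?_, norm_deriv_le_exp_abs_im hF.realEntire.differentiable (by positivity)
    (norm_le_exp_abs_im hF.realEntire.differentiable hF.exponentialType_le hb)⟩
  positivity

lemma tendsto_atTop (hF : IsMonotoneSignMajorant F) (hfin : signExcess F ≠ ⊤) :
    Tendsto (fun x : ℝ => (F x).re) atTop (nhds 1) := by
  refine tendsto_of_antitoneOn_of_lintegral_ne_top hF.antitoneOn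
    (fun x hx => by simpa [Real.sign_of_pos hx] using hF.sign_le x) (ne_top_of_le_ne_top hfin ?_)
  rw [signExcess, lintegral_eq_Ioi_add_Ioi_neg]
  refine le_trans (le_of_eq ?_) le_self_add
  refine setLIntegral_congr_fun measurableSet_Ioi fun x hx => ?_
  rw [Real.sign_of_pos hx]

lemma tendsto_atBot (hF : IsMonotoneSignMajorant F) (hfin : signExcess F ≠ ⊤) :
    Tendsto (fun x : ℝ => (F x).re) atBot (nhds (-1)) := by
  have key : Tendsto (fun x : ℝ => (F (-x : ℝ)).re) atTop (nhds (-1)) := by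
    refine tendsto_of_antitoneOn_of_lintegral_ne_top (fun x hx y hy hxy => ?_)
      (fun x hx => ?_) (ne_top_of_le_ne_top hfin ?_)
    · exact hF.monotoneOn (by simpa using hy) (by simpa using hx) (neg_le_neg hxy)
    · have := hF.sign_le (-x)
      rwa [Real.sign_of_neg (by simpa using hx)] at this
    · rw [signExcess, lintegral_eq_Ioi_add_Ioi_neg]
      refine le_trans (le_of_eq ?_) le_add_self
      refine setLIntegral_congr_fun measurableSet_Ioi fun x hx => ?_
      rw [Real.sign_of_neg (by simpa using hx)]
  simpa [Function.comp_def] using key.comp tendsto_neg_atBot_atTop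

lemma signExcess_eq (hF : IsMonotoneSignMajorant F) (hfin : signExcess F ≠ ⊤) :
    signExcess F = ∫⁻ x : ℝ, ENNReal.ofReal (-x * (deriv F x).re) :=
  lintegral_sub_sign_eq hF.hasDerivAt_re hF.continuous_re_deriv
    (fun _ hx => hF.re_deriv_nonpos hx.le) (fun _ hx => hF.re_deriv_nonneg hx.le)
    (hF.tendsto_atTop hfin) (hF.tendsto_atBot hfin)

lemma neg_mul_re_deriv_nonneg (hF : IsMonotoneSignMajorant F) (x : ℝ) :
    0 ≤ -x * (deriv F x).re := by
  rcases le_total 0 x with h | h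
  · nlinarith [hF.re_deriv_nonpos h]
  · nlinarith [hF.re_deriv_nonneg h]

lemma integrable_neg_mul_re_deriv (hF : IsMonotoneSignMajorant F) (hfin : signExcess F ≠ ⊤) :
    Integrable fun x : ℝ => -x * (deriv F x).re := by
  refine ⟨(continuous_neg.mul hF.continuous_re_deriv).aestronglyMeasurable, ?_⟩
  rw [hasFiniteIntegral_iff_ofReal (Eventually.of_forall hF.neg_mul_re_deriv_nonneg),
    ← hF.signExcess_eq hfin]
  exact hfin.lt_top

lemma signExcess_eq_ofReal (hF : IsMonotoneSignMajorant F) (hfin : signExcess F ≠ ⊤) :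
    signExcess F = ENNReal.ofReal (∫ x : ℝ, -x * (deriv F x).re) := by
  rw [hF.signExcess_eq hfin, ofReal_integral_eq_lintegral_ofReal
    (hF.integrable_neg_mul_re_deriv hfin) (Eventually.of_forall hF.neg_mul_re_deriv_nonneg)]

lemma integrable_re_deriv (hF : IsMonotoneSignMajorant F) (hfin : signExcess F ≠ ⊤) :
    Integrable fun x : ℝ => (deriv F x).re := by
  have hc := hF.continuous_re_deriv
  have h1 : Integrable ((Icc (-1 : ℝ) 1).indicator fun x : ℝ => ‖(deriv F x).re‖) :=
    (integrable_indicator_iff measurableSet_Icc).2 hc.norm.continuousOn.integrableOn_Icc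
  refine ((hF.integrable_neg_mul_re_deriv hfin).add h1).mono' hc.aestronglyMeasurable
    (Eventually.of_forall fun x => ?_)
  have h2 := hF.neg_mul_re_deriv_nonneg x
  by_cases hx : x ∈ Icc (-1 : ℝ) 1
  · simpa [indicator_of_mem hx] using h2
  · have hx1 : 1 ≤ |x| := by
      by_contra! h
      exact hx (abs_le.1 h.le)
    simp only [Pi.add_apply, indicator_of_notMem hx, add_zero]
    calc ‖(deriv F x).re‖ ≤ |x| * ‖(deriv F x).re‖ := le_mul_of_one_le_left (norm_nonneg _) hx1
      _ = |(-x * (deriv F x).re)| := by rw [abs_mul, abs_neg, Real.norm_eq_abs]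
      _ = _ := abs_of_nonneg h2

lemma integral_re_deriv (hF : IsMonotoneSignMajorant F) (hfin : signExcess F ≠ ⊤) :
    ∫ x : ℝ, (deriv F x).re = 2 := by
  rw [integral_of_hasDerivAt_of_tendsto hF.hasDerivAt_re (hF.integrable_re_deriv hfin)
    (hF.tendsto_atBot hfin) (hF.tendsto_atTop hfin)]
  norm_num

end IsMonotoneSignMajorant

/-! ### Sampling the derivative -/

namespace IsMonotoneSignMajorant

variable {F : ℂ → ℂ}

/-- The bound that makes the sampling formula applicable to `(z + δ) F'(z)`, damped by the fourth
power of a dilated sinc function. -/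
lemma exists_norm_damped_le (hF : IsMonotoneSignMajorant F) {η δ : ℝ} (hη : 0 < η) (hη1 : η ≤ 1)
    (hδ : 0 < δ) (hδ1 : δ ≤ 1) :
    ∃ C : ℝ, ∀ z : ℂ, ‖-(z + δ) * deriv F z * sincPi (η * z) ^ 4‖ ≤
      C * Real.exp ((2 * Real.pi + 4 * Real.pi * η) * |z.im|) / (1 + z.re ^ 2) := by
  obtain ⟨A, hA0, hA⟩ := hF.exists_norm_deriv_le
  obtain ⟨B, hB0, hB⟩ := exists_norm_sincPi_le
  refine ⟨A * (B / η) ^ 4, fun z => ?_⟩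
  have hz : 1 ≤ 1 + ‖z‖ := by linarith [norm_nonneg z]
  have h1 : ‖-(z + δ)‖ ≤ (1 + ‖z‖) ^ 2 := by
    rw [norm_neg]
    have := norm_add_le z (δ : ℂ)
    rw [Complex.norm_real, Real.norm_of_nonneg hδ.le] at this
    nlinarith [norm_nonneg z]
  have h2 : ‖sincPi (η * z)‖ ≤ B / η * Real.exp (Real.pi * η * |z.im|) / (1 + ‖z‖) := by
    refine (hB _).trans ?_
    rw [Complex.im_ofReal_mul, abs_mul, abs_of_pos hη, norm_mul, Complex.norm_real,
      Real.norm_of_nonneg hη.le, div_mul_eq_mul_div, div_div, ← mul_assoc]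
    gcongr
    linarith
  rw [norm_mul, norm_mul, norm_pow]
  calc _ ≤ (1 + ‖z‖) ^ 2 * (A * Real.exp (2 * Real.pi * |z.im|)) *
        (B / η * Real.exp (Real.pi * η * |z.im|) / (1 + ‖z‖)) ^ 4 := by
        gcongr
        exact hA z
    _ = A * (B / η) ^ 4 * Real.exp ((2 * Real.pi + 4 * Real.pi * η) * |z.im|) /
        (1 + ‖z‖) ^ 2 := by
        have he : Real.exp ((2 * Real.pi + 4 * Real.pi * η) * |z.im|) =
            Real.exp (2 * Real.pi * |z.im|) * Real.exp (Real.pi * η * |z.im|) ^ 4 := by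
          rw [← Real.exp_nat_mul, ← Real.exp_add]
          congr 1
          push_cast
          ring
        rw [he]
        field_simp
    _ ≤ _ := exp_div_sq_le (by positivity) z

/-- Each term of the damped sampling sum is non-negative, hence at most the integral. -/
lemma sample_le_integral (hF : IsMonotoneSignMajorant F) {η : ℝ}
    (hη : 0 < η) (hη1 : η < 1 / 2) (n : ℤ) :
    (1 - 2 * η) * (-((1 - 2 * η) * n + (1 - 2 * η)) * (deriv F ((1 - 2 * η) * n : ℝ)).re *
      (sincPi (η * ((1 - 2 * η) * n : ℝ))).re ^ 4) ≤
    ∫ x : ℝ, -(x + (1 - 2 * η)) * (deriv F x).re * (sincPi (η * x)).re ^ 4 := by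
  set δ : ℝ := 1 - 2 * η with hδdef
  have hδ : 0 < δ := by linarith
  have hδ1 : δ ≤ 1 := by linarith
  obtain ⟨C, hC⟩ := hF.exists_norm_damped_le hη (by linarith) hδ hδ1
  have hd : Differentiable ℂ fun z => -(z + δ) * deriv F z * sincPi (η * z) ^ 4 := by
    have h1 := hF.realEntire.deriv.differentiable
    have h2 := differentiable_sincPi
    fun_prop
  have hsum := hasSum_int_smul hd hδ hδ1 (by
    have : (1 - 2 * η) * (1 + 2 * η) < 1 := by nlinarith
    nlinarith [Real.pi_pos]) hC
  have hreal : ∀ x : ℝ, -((x : ℂ) + δ) * deriv F x * sincPi (η * x) ^ 4 =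
      ((-(x + δ) * (deriv F x).re * (sincPi (η * x)).re ^ 4 : ℝ) : ℂ) := by
    intro x
    have h1 := hF.realEntire.deriv.ofReal_re x
    have h2 := ofReal_re_sincPi (η * x)
    push_cast at h2 ⊢
    rw [h1, h2]
  have hterm : ∀ m : ℤ, (δ : ℂ) * (-((δ : ℂ) * m + δ) * deriv F (δ * m) *
      sincPi (η * (δ * m)) ^ 4) = ((δ * (-(δ * m + δ) * (deriv F (δ * m : ℝ)).re *
        (sincPi (η * (δ * m : ℝ))).re ^ 4) : ℝ) : ℂ) := by
    intro m
    have := hreal (δ * m)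
    push_cast at this ⊢
    rw [this]
  simp_rw [hreal, hterm] at hsum
  rw [integral_complex_ofReal] at hsum
  rw [Complex.hasSum_ofReal] at hsum
  refine le_hasSum hsum n fun m _ => ?_
  refine mul_nonneg hδ.le (mul_nonneg ?_ (by positivity))
  rcases le_or_gt 0 m with hm | hm
  · have hm' : (0 : ℝ) ≤ m := by exact_mod_cast hm
    have := hF.re_deriv_nonpos (x := δ * m) (by positivity)
    nlinarith [mul_nonneg hδ.le hm']
  · have hm' : (m : ℝ) + 1 ≤ 0 := by exact_mod_cast hm
    have := hF.re_deriv_nonneg (x := δ * m) (by nlinarith)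
    refine mul_nonneg ?_ this
    nlinarith

/-- The limit `η → 0` of `sample_le_integral`. For `n = -1` the left-hand side vanishes, which gives
the lower bound for the integral; if that bound is attained, `F'` vanishes at all other integers. -/
lemma neg_add_one_mul_re_deriv_le (hF : IsMonotoneSignMajorant F) (hfin : signExcess F ≠ ⊤)
    (n : ℤ) : -((n : ℝ) + 1) * (deriv F (n : ℝ)).re ≤ (∫ x : ℝ, -x * (deriv F x).re) - 2 := by
  have hcS := differentiable_sincPi.continuous
  have hcF := hF.realEntire.deriv.differentiable.continuous
  have hev : ∀ᶠ η : ℝ in nhdsWithin 0 (Ioi 0), 0 < η ∧ η < 1 / 2 :=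
    Ioo_mem_nhdsGT (by norm_num)
  obtain ⟨B, hB0, hB⟩ := exists_norm_sincPi_le
  have hSb : ∀ x : ℝ, |(sincPi x).re| ≤ B := fun x => by
    refine (Complex.abs_re_le_norm _).trans ((hB x).trans ?_)
    rw [Complex.ofReal_im, abs_zero, mul_zero, Real.exp_zero, mul_one]
    exact div_le_self hB0.le (by linarith [norm_nonneg (x : ℂ)])
  have hl : Tendsto (fun η : ℝ => (1 - 2 * η) * (-((1 - 2 * η) * n + (1 - 2 * η)) *
      (deriv F ((1 - 2 * η) * n : ℝ)).re * (sincPi (η * ((1 - 2 * η) * n : ℝ))).re ^ 4))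
      (nhdsWithin 0 (Ioi 0)) (nhds (-((n : ℝ) + 1) * (deriv F (n : ℝ)).re)) := by
    have hc : Continuous (fun η : ℝ => (1 - 2 * η) * (-((1 - 2 * η) * n + (1 - 2 * η)) *
        (deriv F ((1 - 2 * η) * n : ℝ)).re * (sincPi (η * ((1 - 2 * η) * n : ℝ))).re ^ 4)) := by
      fun_prop
    have := (hc.tendsto 0).mono_left (nhdsWithin_le_nhds (s := Ioi 0))
    simpa [sincPi_zero] using this
  have hH := hF.integrable_neg_mul_re_deriv hfin
  have hU := hF.integrable_re_deriv hfin
  have hr : Tendsto (fun η : ℝ =>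
      ∫ x : ℝ, -(x + (1 - 2 * η)) * (deriv F x).re * (sincPi (η * x)).re ^ 4)
      (nhdsWithin 0 (Ioi 0)) (nhds ((∫ x : ℝ, -x * (deriv F x).re) - 2)) := by
    have heq : (∫ x : ℝ, -x * (deriv F x).re) - 2 = ∫ x : ℝ, -(x + 1) * (deriv F x).re := by
      rw [← hF.integral_re_deriv hfin, ← integral_sub hH hU]
      congr 1 with x
      ring
    rw [heq]
    refine tendsto_integral_filter_of_dominated_convergence
      (fun x : ℝ => (‖-x * (deriv F x).re‖ + ‖(deriv F x).re‖) * B ^ 4) ?_ ?_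
      ((hH.norm.add hU.norm).mul_const _) ?_
    · exact Eventually.of_forall fun η => Continuous.aestronglyMeasurable (by fun_prop)
    · filter_upwards [hev] with η hη
      refine Eventually.of_forall fun x => ?_
      rw [norm_mul, norm_pow]
      have h1 : ‖-(x + (1 - 2 * η)) * (deriv F x).re‖ ≤
          ‖-x * (deriv F x).re‖ + ‖(deriv F x).re‖ := by
        rw [show -(x + (1 - 2 * η)) * (deriv F x).re =
          -x * (deriv F x).re - (1 - 2 * η) * (deriv F x).re by ring]
        refine (norm_sub_le _ _).trans (add_le_add le_rfl ?_)
        rw [norm_mul, Real.norm_of_nonneg (by linarith : 0 ≤ 1 - 2 * η)]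
        exact mul_le_of_le_one_left (norm_nonneg _) (by linarith)
      have h2 : ‖(sincPi (η * x)).re‖ ≤ B := by
        have := hSb (η * x)
        push_cast at this
        exact this
      gcongr
    · refine Eventually.of_forall fun x => ?_
      have hc : Continuous fun η : ℝ =>
          -(x + (1 - 2 * η)) * (deriv F x).re * (sincPi (η * x)).re ^ 4 := by fun_prop
      have := (hc.tendsto 0).mono_left (nhdsWithin_le_nhds (s := Ioi 0))
      simpa [sincPi_zero] using this
  refine le_of_tendsto_of_tendsto hl hr ?_
  filter_upwards [hev] with η hη
  exact hF.sample_le_integral hη.1 hη.2 n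

lemma two_le_integral (hF : IsMonotoneSignMajorant F) (hfin : signExcess F ≠ ⊤) :
    2 ≤ ∫ x : ℝ, -x * (deriv F x).re := by
  have := hF.neg_add_one_mul_re_deriv_le hfin (-1)
  push_cast at this
  linarith

lemma two_le_signExcess (hF : IsMonotoneSignMajorant F) : 2 ≤ signExcess F := by
  by_cases hfin : signExcess F = ⊤
  · rw [hfin]
    exact le_top
  · rw [hF.signExcess_eq_ofReal hfin, ← ENNReal.ofReal_ofNat 2]
    exact ENNReal.ofReal_le_ofReal (hF.two_le_integral hfin)

lemma deriv_int_eq_zero (hF : IsMonotoneSignMajorant F) (h2 : signExcess F = 2) {n : ℤ}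
    (hn : n ≠ -1) : deriv F n = 0 := by
  have hfin : signExcess F ≠ ⊤ := by rw [h2]; exact ENNReal.ofNat_ne_top
  have hI : ∫ x : ℝ, -x * (deriv F x).re = 2 := by
    have h := hF.signExcess_eq_ofReal hfin
    have h0 : 0 ≤ ∫ x : ℝ, -x * (deriv F x).re := by linarith [hF.two_le_integral hfin]
    have := congrArg ENNReal.toReal (h.symm.trans h2)
    rwa [ENNReal.toReal_ofReal h0, ENNReal.toReal_ofNat] at this
  have hle := hF.neg_add_one_mul_re_deriv_le hfin n
  rw [hI, sub_self] at hle
  have hre : (deriv F (n : ℝ)).re = 0 := by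
    rcases lt_or_ge n 0 with h | h
    · have hn' : (n : ℝ) + 1 < 0 := by exact_mod_cast (by omega : n + 1 < 0)
      have := hF.re_deriv_nonneg (x := n) (by linarith)
      nlinarith
    · have hn' : (0 : ℝ) ≤ n := by exact_mod_cast h
      have := hF.re_deriv_nonpos hn'
      nlinarith
  have := hF.realEntire.deriv.ofReal_re n
  rw [hre] at this
  simpa using this.symm

end IsMonotoneSignMajorant

/-! ### Division by `sin² (π z)` and polynomial growth -/

lemma sin_pi_mul_int (n : ℤ) : Complex.sin (Real.pi * n) = 0 := by
  rw [mul_comm, Complex.sin_int_mul_pi]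

lemma hasDerivAt_sin_pi_mul (z : ℂ) :
    HasDerivAt (fun w : ℂ => Complex.sin (Real.pi * w)) (Complex.cos (Real.pi * z) * Real.pi) z := by
  simpa using ((hasDerivAt_id z).const_mul (Real.pi : ℂ)).csin

lemma cos_pi_mul_mul_pi_ne_zero {z : ℂ} (hz : Complex.sin (Real.pi * z) = 0) :
    Complex.cos (Real.pi * z) * Real.pi ≠ 0 := by
  refine mul_ne_zero (fun h => ?_) (by exact_mod_cast Real.pi_ne_zero)
  have := Complex.sin_sq_add_cos_sq (Real.pi * z)
  rw [hz, h] at this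
  norm_num at this

lemma exists_eq_int_of_sin_pi_mul_eq_zero {z : ℂ} (hz : Complex.sin (Real.pi * z) = 0) :
    ∃ n : ℤ, z = n := by
  have hpi : (Real.pi : ℂ) ≠ 0 := by exact_mod_cast Real.pi_ne_zero
  obtain ⟨n, hn⟩ := Complex.sin_eq_zero_iff.1 hz
  exact ⟨n, mul_left_cancel₀ hpi (by rw [hn, mul_comm])⟩

/-- An entire function vanishing at the integers is divisible by `sin (π z)`. -/
lemma exists_eq_mul_sin {N : ℂ → ℂ} (hN : Differentiable ℂ N) (h0 : ∀ n : ℤ, N n = 0) :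
    ∃ Q : ℂ → ℂ, Differentiable ℂ Q ∧ ∀ z, N z = Q z * Complex.sin (Real.pi * z) := by
  classical
  set s : ℂ → ℂ := fun w => Complex.sin (Real.pi * w) with hs
  have hsd : Differentiable ℂ s := by fun_prop
  set Q : ℂ → ℂ := fun z => if s z = 0 then deriv N z / deriv s z else N z / s z with hQ
  refine ⟨Q, fun z => ?_, fun z => ?_⟩
  · by_cases hz : s z = 0
    · obtain ⟨n, rfl⟩ := exists_eq_int_of_sin_pi_mul_eq_zero hz
      have hd : ∀ f : ℂ → ℂ, Differentiable ℂ f → Differentiable ℂ (dslope f n) := fun f hf =>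
        differentiableOn_univ.1 ((Complex.differentiableOn_dslope univ_mem).2 hf.differentiableOn)
      have hsn : dslope s n n ≠ 0 := by
        rw [dslope_same, (hasDerivAt_sin_pi_mul _).deriv]
        exact cos_pi_mul_mul_pi_ne_zero hz
      have heq : Q =ᶠ[nhds (n : ℂ)] fun w => dslope N n w / dslope s n w := by
        filter_upwards [(hd s hsd).continuous.continuousAt.eventually_ne hsn] with w hw
        rcases eq_or_ne w n with rfl | hwn
        · simp only [hQ, if_pos hz, dslope_same]
        · have hwn' : w - n ≠ 0 := sub_ne_zero.2 hwn
          have h1 := sub_smul_dslope N n w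
          have h2 := sub_smul_dslope s n w
          rw [h0, sub_zero, smul_eq_mul] at h1
          rw [hz, sub_zero, smul_eq_mul] at h2
          have h3 : s w ≠ 0 := h2 ▸ mul_ne_zero hwn' hw
          simp only [hQ, if_neg h3]
          rw [← h1, ← h2, mul_div_mul_left _ _ hwn']
      exact (((hd N hN) n).div ((hd s hsd) n) hsn).congr_of_eventuallyEq heq
    · have heq : Q =ᶠ[nhds z] fun w => N w / s w := by
        filter_upwards [hsd.continuous.continuousAt.eventually_ne hz] with w hw
        simp only [hQ, if_neg hw]
      exact ((hN z).div (hsd z) hz).congr_of_eventuallyEq heq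
  · by_cases hz : s z = 0
    · obtain ⟨n, rfl⟩ := exists_eq_int_of_sin_pi_mul_eq_zero hz
      rw [h0, show Complex.sin (Real.pi * n) = 0 from hz, mul_zero]
    · simp only [hQ, if_neg hz]
      rw [div_mul_cancel₀ _ hz]

/-- An entire function with (at least) double zeros at the integers is divisible by
`sin² (π z)`. -/
lemma exists_eq_mul_sin_sq {N : ℂ → ℂ} (hN : Differentiable ℂ N) (h0 : ∀ n : ℤ, N n = 0)
    (h1 : ∀ n : ℤ, deriv N n = 0) :
    ∃ Q : ℂ → ℂ, Differentiable ℂ Q ∧ ∀ z, N z = Q z * Complex.sin (Real.pi * z) ^ 2 := by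
  obtain ⟨P, hP, hNP⟩ := exists_eq_mul_sin hN h0
  obtain ⟨Q, hQ, hPQ⟩ := exists_eq_mul_sin hP fun n => by
    have hd := ((hP n).hasDerivAt.mul (hasDerivAt_sin_pi_mul n)).deriv
    rw [show P * (fun w : ℂ => Complex.sin (Real.pi * w)) = N from (funext hNP).symm, h1,
      sin_pi_mul_int, mul_zero, zero_add] at hd
    exact (mul_eq_zero.1 hd.symm).resolve_right (cos_pi_mul_mul_pi_ne_zero (sin_pi_mul_int n))
  exact ⟨Q, hQ, fun z => by rw [hNP, hPQ]; ring⟩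

lemma norm_sin_sq (z : ℂ) :
    ‖Complex.sin z‖ ^ 2 = Real.sin z.re ^ 2 + Real.sinh z.im ^ 2 := by
  have h : Complex.sin z = ((Real.sin z.re * Real.cosh z.im : ℝ) : ℂ) +
      ((Real.cos z.re * Real.sinh z.im : ℝ) : ℂ) * Complex.I := by
    rw [Complex.sin_eq]
    push_cast
    ring
  rw [h, ← Complex.normSq_eq_norm_sq, Complex.normSq_add_mul_I]
  have h1 := Real.cosh_sq z.im
  have h2 := Real.sin_sq_add_cos_sq z.re
  rw [mul_pow, mul_pow, h1]
  linear_combination (Real.sinh z.im ^ 2) * h2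

/-- In the strip `|x - n| ≤ 1/2`, away from the zero `n`, the sine is as large as its type
permits. -/
lemma exp_le_mul_norm_sin {z : ℂ} {n : ℤ} (hn : |z.re - n| ≤ 1 / 2) (hz : 1 / 2 ≤ ‖z - n‖) :
    Real.exp (Real.pi * |z.im|) ≤ 2 * Real.exp Real.pi * ‖Complex.sin (Real.pi * z)‖ := by
  have hpi := Real.pi_gt_three
  have hsq := norm_sin_sq (Real.pi * z)
  rw [Complex.re_ofReal_mul, Complex.im_ofReal_mul] at hsq
  have hS := norm_nonneg (Complex.sin (Real.pi * z))
  have he : 4 ≤ Real.exp Real.pi := by linarith [Real.add_one_le_exp Real.pi]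
  rcases le_or_gt (1 / 4) |z.im| with h | h
  · set a := Real.pi * |z.im| with ha
    have ha1 : 3 / 4 ≤ a := by nlinarith
    have hsh : Real.sinh a ≤ ‖Complex.sin (Real.pi * z)‖ := by
      refine le_of_sq_le_sq ?_ hS
      have : Real.sinh a ^ 2 = Real.sinh (Real.pi * z.im) ^ 2 := by
        rw [ha, ← abs_of_pos Real.pi_pos, ← abs_mul, abs_of_pos Real.pi_pos]
        rcases abs_choice (Real.pi * z.im) with h | h <;> rw [h]
        rw [Real.sinh_neg, neg_sq]
      rw [hsq, this]
      nlinarith [sq_nonneg (Real.sin (Real.pi * z.re))]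
    have h2 : Real.exp a ≤ 4 * Real.sinh a := by
      rw [Real.sinh_eq]
      have h3 := Real.add_one_le_exp a
      have h4 : Real.exp a * Real.exp (-a) = 1 := by rw [← Real.exp_add]; simp
      nlinarith [Real.exp_pos (-a)]
    calc Real.exp a ≤ 4 * ‖Complex.sin (Real.pi * z)‖ := by linarith
      _ ≤ _ := by gcongr; linarith
  · have hre : 1 / 4 ≤ |z.re - n| := by
      have h1 := Complex.norm_le_abs_re_add_abs_im (z - n)
      simp only [Complex.sub_re, Complex.intCast_re, Complex.sub_im, Complex.intCast_im,
        sub_zero] at h1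
      linarith
    have hsin : 1 / 2 ≤ ‖Complex.sin (Real.pi * z)‖ := by
      refine le_of_sq_le_sq ?_ hS
      have h1 : Real.sin (Real.pi * z.re) ^ 2 = Real.sin (Real.pi * |z.re - n|) ^ 2 := by
        have h2 : Real.sin (Real.pi * (z.re - n)) ^ 2 = Real.sin (Real.pi * z.re) ^ 2 := by
          rw [mul_sub, mul_comm Real.pi (n : ℝ), Real.sin_sub_int_mul_pi, mul_pow]
          rcases Int.even_or_odd n with he | ho
          · rw [he.neg_one_zpow]; norm_num
          · rw [ho.neg_one_zpow]; norm_num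
        rw [← h2]
        rcases abs_choice (z.re - n) with h | h <;> rw [h]
        rw [mul_neg, Real.sin_neg, neg_sq]
      have h3 := Real.mul_le_sin (x := Real.pi * |z.re - n|) (by positivity) (by nlinarith)
      have h4 : 2 / Real.pi * (Real.pi * |z.re - n|) = 2 * |z.re - n| := by
        field_simp
      rw [hsq, h1]
      nlinarith [sq_nonneg (Real.sinh (Real.pi * z.im))]
    calc Real.exp (Real.pi * |z.im|) ≤ Real.exp Real.pi := by
          apply Real.exp_le_exp.2
          nlinarith
      _ = 2 * Real.exp Real.pi * (1 / 2) := by ring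
      _ ≤ _ := by gcongr

/-- If `Q sin² (π z)` is of type `2π` up to a polynomial factor, then `Q` has polynomial growth. Near
the integers this follows from the maximum principle on discs of radius `1/2`. -/
lemma exists_norm_le_of_mul_sin_sq {N Q : ℂ → ℂ} (hQ : Differentiable ℂ Q)
    (hNQ : ∀ z, N z = Q z * Complex.sin (Real.pi * z) ^ 2) {A : ℝ} {k : ℕ}
    (hN : ∀ z : ℂ, ‖N z‖ ≤ A * (1 + ‖z‖) ^ k * Real.exp (2 * Real.pi * |z.im|)) :
    ∃ C : ℝ, ∀ z, ‖Q z‖ ≤ C * (1 + ‖z‖) ^ k := by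
  have hA : 0 ≤ A := by simpa using (norm_nonneg _).trans (hN 0)
  set B : ℝ := A * (2 * Real.exp Real.pi) ^ 2 with hB
  have hB0 : 0 ≤ B := by positivity
  have hout : ∀ (z : ℂ) (n : ℤ), |z.re - n| ≤ 1 / 2 → 1 / 2 ≤ ‖z - n‖ →
      ‖Q z‖ ≤ B * (1 + ‖z‖) ^ k := by
    intro z n h1 h2
    have h3 := exp_le_mul_norm_sin h1 h2
    set S := ‖Complex.sin (Real.pi * z)‖ with hS
    have hSpos : 0 < S := by
      by_contra! h
      have : 2 * Real.exp Real.pi * S ≤ 0 :=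
        mul_nonpos_of_nonneg_of_nonpos (by positivity) h
      linarith [Real.exp_pos (Real.pi * |z.im|)]
    have h4 := hN z
    rw [hNQ, norm_mul, norm_pow, ← hS] at h4
    have h5 : Real.exp (2 * Real.pi * |z.im|) ≤ (2 * Real.exp Real.pi * S) ^ 2 := by
      rw [show 2 * Real.pi * |z.im| = (2 : ℕ) * (Real.pi * |z.im|) by push_cast; ring,
        Real.exp_nat_mul]
      gcongr
    refine le_of_mul_le_mul_right (h4.trans ?_) (pow_pos hSpos 2)
    calc _ ≤ A * (1 + ‖z‖) ^ k * (2 * Real.exp Real.pi * S) ^ 2 := by gcongr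
      _ = _ := by rw [hB]; ring
  refine ⟨B * 2 ^ k, fun z => ?_⟩
  have hround : |z.re - round z.re| ≤ 1 / 2 := abs_sub_round z.re
  rcases le_or_gt (1 / 2) ‖z - (round z.re : ℤ)‖ with h | h
  · refine (hout z _ hround h).trans ?_
    gcongr
    exact le_mul_of_one_le_right hB0 (one_le_pow₀ (by norm_num))
  · have hmem : z ∈ Metric.ball ((round z.re : ℤ) : ℂ) (1 / 2) := by
      rwa [mem_ball_iff_norm]
    refine Complex.norm_le_of_forall_mem_frontier_norm_le Metric.isBounded_ball
      hQ.diffContOnCl (fun w hw => ?_) (subset_closure hmem)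
    rw [frontier_ball _ (by norm_num), mem_sphere_iff_norm] at hw
    have hwre : |w.re - (round z.re : ℤ)| ≤ 1 / 2 := by
      have := Complex.abs_re_le_norm (w - (round z.re : ℤ))
      rw [hw] at this
      simpa using this
    refine (hout w _ hwre hw.ge).trans ?_
    have hwz : ‖w‖ ≤ ‖z‖ + 1 := by
      have h1 : ‖w - z‖ ≤ ‖w - (round z.re : ℤ)‖ + ‖z - (round z.re : ℤ)‖ := by
        simpa using norm_sub_le (w - (round z.re : ℤ)) (z - (round z.re : ℤ))
      have h2 := norm_sub_norm_le w z
      linarith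
    calc B * (1 + ‖w‖) ^ k ≤ B * (2 * (1 + ‖z‖)) ^ k := by
          gcongr
          linarith [norm_nonneg z]
      _ = _ := by rw [mul_pow]; ring

/-- An entire function of polynomial growth is constant or grows at least linearly. -/
lemma eq_const_or_linear_growth {k : ℕ} {Q : ℂ → ℂ} (hQ : Differentiable ℂ Q) {C : ℝ}
    (hC : ∀ z, ‖Q z‖ ≤ C * (1 + ‖z‖) ^ k) :
    (∀ z, Q z = Q 0) ∨ ∃ c > 0, ∀ᶠ z in Bornology.cobounded ℂ, c * ‖z‖ ≤ ‖Q z‖ := by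
  induction k generalizing Q C with
  | zero =>
    left
    intro z
    refine hQ.apply_eq_apply_of_bounded ?_ z 0
    exact isBounded_iff_forall_norm_le.2 ⟨C, by rintro _ ⟨w, rfl⟩; simpa using hC w⟩
  | succ k ih =>
    have hC0 : 0 ≤ C := by simpa using (norm_nonneg _).trans (hC 0)
    set P : ℂ → ℂ := dslope Q 0 with hP
    have hPd : Differentiable ℂ P :=
      differentiableOn_univ.1 ((Complex.differentiableOn_dslope univ_mem).2 hQ.differentiableOn)
    have hQP : ∀ z, z * P z = Q z - Q 0 := fun z => by
      simpa using sub_smul_dslope Q 0 z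
    obtain ⟨A, hA⟩ := (isCompact_closedBall (0 : ℂ) 1).exists_bound_of_continuousOn
      hPd.continuous.continuousOn
    have hA0 : 0 ≤ A := (norm_nonneg _).trans (hA 0 (by simp))
    have hPb : ∀ z, ‖P z‖ ≤ (A + 4 * C) * (1 + ‖z‖) ^ k := by
      intro z
      have h1 : 1 ≤ (1 + ‖z‖) ^ k := one_le_pow₀ (by linarith [norm_nonneg z])
      rcases le_total ‖z‖ 1 with h | h
      · have := hA z (by simpa using h)
        nlinarith
      · have h2 := congrArg norm (hQP z)
        rw [norm_mul] at h2
        have h3 := norm_sub_le (Q z) (Q 0)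
        have h4 := hC z
        have h5 : ‖Q 0‖ ≤ C := by simpa using hC 0
        have h6 : ‖z‖ * ‖P z‖ ≤ ‖z‖ * (4 * C * (1 + ‖z‖) ^ k) := by
          rw [pow_succ] at h4
          have h7 : C ≤ C * (1 + ‖z‖) ^ k := le_mul_of_one_le_right hC0 h1
          have h8 : C * (1 + ‖z‖) ^ k ≤ ‖z‖ * (C * (1 + ‖z‖) ^ k) :=
            le_mul_of_one_le_left (by positivity) h
          nlinarith
        have h9 := le_of_mul_le_mul_left h6 (by linarith)
        nlinarith
    have hbig : ∀ R : ℝ, ∀ᶠ z in Bornology.cobounded ℂ, R ≤ ‖z‖ := fun R =>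
      tendsto_norm_cobounded_atTop.eventually_ge_atTop R
    have hlow : ∀ z, ‖z‖ * ‖P z‖ - ‖Q 0‖ ≤ ‖Q z‖ := fun z => by
      rw [← norm_mul, hQP]
      have := norm_sub_le (Q z) (Q 0)
      linarith
    rcases ih hPd hPb with h | ⟨c, hc, h⟩
    · by_cases hb : P 0 = 0
      · left
        intro z
        have := hQP z
        rw [h, hb, mul_zero] at this
        exact sub_eq_zero.1 this.symm
      · right
        have hb' : 0 < ‖P 0‖ := norm_pos_iff.2 hb
        refine ⟨‖P 0‖ / 2, by positivity, ?_⟩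
        filter_upwards [hbig (2 * ‖Q 0‖ / ‖P 0‖)] with z hz
        rw [div_le_iff₀ hb'] at hz
        have := hlow z
        rw [h] at this
        linarith
    · right
      refine ⟨1, one_pos, ?_⟩
      filter_upwards [h, hbig (2 / c), hbig ‖Q 0‖] with z h1 h2 h3
      rw [div_le_iff₀ hc] at h2
      nlinarith [hlow z, norm_nonneg z]

/-! ### The derivative of an extremal function -/

lemma IsRealEntire.deriv_eq_zero_of_re_deriv_eq_zero {G : ℂ → ℂ} (hG : IsRealEntire G) {x : ℝ}
    (h : _root_.deriv (fun y : ℝ => (G y).re) x = 0) : _root_.deriv G x = 0 := by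
  rw [(hasDerivAt_re_ofReal hG.differentiable x).deriv] at h
  have := hG.deriv.ofReal_re x
  rw [h] at this
  simpa using this.symm

namespace IsMonotoneSignMajorant

variable {F : ℂ → ℂ}

/-- At integers other than `0` and `-1` the derivative of an extremal function has a zero where it
does not change sign. -/
lemma deriv_deriv_int_eq_zero (hF : IsMonotoneSignMajorant F) (h2 : signExcess F = 2) {n : ℤ}
    (hn : n ≠ -1) (hn0 : n ≠ 0) : deriv (deriv F) n = 0 := by
  have h0 := hF.deriv_int_eq_zero h2 hn
  have h0' : (deriv F (n : ℝ)).re = 0 := by simp [h0]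
  have key : deriv (fun y : ℝ => (deriv F y).re) (n : ℝ) = 0 := by
    rcases lt_or_gt_of_ne hn0 with h | h
    · refine IsLocalMin.deriv_eq_zero ?_
      have : Iio (0 : ℝ) ∈ nhds (n : ℝ) := Iio_mem_nhds (by exact_mod_cast h)
      filter_upwards [this] with y hy
      simp only [h0']
      exact hF.re_deriv_nonneg (le_of_lt hy)
    · refine IsLocalMax.deriv_eq_zero ?_
      have : Ioi (0 : ℝ) ∈ nhds (n : ℝ) := Ioi_mem_nhds (by exact_mod_cast h)
      filter_upwards [this] with y hy
      simp only [h0']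
      exact hF.re_deriv_nonpos (le_of_lt hy)
  exact_mod_cast hF.realEntire.deriv.deriv_eq_zero_of_re_deriv_eq_zero key

/-- The quotient `F'(z) z (z + 1)² / sin² (π z)` is entire and of polynomial growth; if it were not
constant, `x F'(x)` would not be integrable. -/
lemma exists_const_deriv (hF : IsMonotoneSignMajorant F) (h2 : signExcess F = 2) :
    ∃ a : ℂ, ∀ z, deriv F z * (z * (z + 1) ^ 2) = a * Complex.sin (Real.pi * z) ^ 2 := by
  have hfin : signExcess F ≠ ⊤ := by rw [h2]; exact ENNReal.ofNat_ne_top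
  have hFd := hF.realEntire.deriv.differentiable
  have hNd : Differentiable ℂ fun z => deriv F z * (z * (z + 1) ^ 2) := by fun_prop
  obtain ⟨Q, hQ, hNQ⟩ := exists_eq_mul_sin_sq hNd
    (fun n => by
      by_cases hn : n = -1
      · simp [hn]
      · simp [hF.deriv_int_eq_zero h2 hn])
    (fun n => by
      have hd : HasDerivAt (fun z : ℂ => z * (z + 1) ^ 2)
          (((n : ℂ) + 1) ^ 2 + n * (2 * (n + 1))) (n : ℂ) := by
        have := (hasDerivAt_id' (n : ℂ)).fun_mul
          (((hasDerivAt_id' (n : ℂ)).add_const 1).fun_pow 2)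
        simpa using this
      rw [((hFd n).hasDerivAt.fun_mul hd).deriv]
      by_cases hn : n = -1
      · simp [hn]
      by_cases hn0 : n = 0
      · have := hF.deriv_int_eq_zero h2 hn
        rw [hn0] at this
        simpa [hn0] using this
      · rw [hF.deriv_int_eq_zero h2 hn, hF.deriv_deriv_int_eq_zero h2 hn hn0]
        ring)
  obtain ⟨A, hA0, hA⟩ := hF.exists_norm_deriv_le
  obtain ⟨C, hC⟩ := exists_norm_le_of_mul_sin_sq (k := 3) (A := A) hQ hNQ (fun z => by
    rw [norm_mul, norm_mul, norm_pow]
    have h1 : ‖z + 1‖ ≤ 1 + ‖z‖ := by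
      have := norm_add_le z 1
      rw [norm_one] at this
      linarith
    calc _ ≤ (A * Real.exp (2 * Real.pi * |z.im|)) * ((1 + ‖z‖) * (1 + ‖z‖) ^ 2) := by
          gcongr
          · exact hA z
          · linarith
      _ = _ := by ring)
  rcases eq_const_or_linear_growth hQ hC with h | ⟨c, hc, h⟩
  · exact ⟨Q 0, fun z => by rw [hNQ, h]⟩
  exfalso
  have hcob : Tendsto (fun x : ℝ => (x : ℂ)) atTop (Bornology.cobounded ℂ) := by
    rw [← tendsto_norm_atTop_iff_cobounded]
    simpa using tendsto_abs_atTop_atTop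
  obtain ⟨R, hR⟩ := eventually_atTop.1 (hcob.eventually h)
  set H : ℝ → ℝ := fun x => -x * (deriv F x).re with hH
  have hHint : Integrable H := hF.integrable_neg_mul_re_deriv hfin
  have hlow : ∀ x : ℝ, R ≤ x → 1 ≤ x → c / (4 * x) * Real.sin (Real.pi * x) ^ 2 ≤ H x := by
    intro x hxR hx1
    have h3 := hR x hxR
    have h4 := congrArg norm (hNQ x)
    rw [norm_mul, norm_mul, norm_mul, norm_pow, norm_pow] at h4
    have hx : ‖(x : ℂ)‖ = x := by rw [Complex.norm_real, Real.norm_of_nonneg (by linarith)]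
    have hx' : ‖(x : ℂ) + 1‖ = x + 1 := by
      rw [← Complex.ofReal_one, ← Complex.ofReal_add, Complex.norm_real,
        Real.norm_of_nonneg (by linarith)]
    have hs : ‖Complex.sin (Real.pi * x)‖ ^ 2 = Real.sin (Real.pi * x) ^ 2 := by
      rw [← Complex.ofReal_mul, ← Complex.ofReal_sin, Complex.norm_real, Real.norm_eq_abs, sq_abs]
    have hHx : ‖deriv F x‖ * x = H x := by
      calc ‖deriv F x‖ * x = |-x * (deriv F x).re| := by
            rw [← hF.realEntire.deriv.ofReal_re x, Complex.norm_real, abs_mul, abs_neg,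
              abs_of_nonneg (by linarith : 0 ≤ x), mul_comm]
            rfl
        _ = H x := abs_of_nonneg (hF.neg_mul_re_deriv_nonneg x)
    rw [hx, hx', hs, ← mul_assoc, hHx] at h4
    rw [hx] at h3
    have h5 : c * x * Real.sin (Real.pi * x) ^ 2 ≤ H x * (2 * x) ^ 2 := by
      have h6 : c * x * Real.sin (Real.pi * x) ^ 2 ≤ ‖Q x‖ * Real.sin (Real.pi * x) ^ 2 := by
        gcongr
      have h7 : H x * (x + 1) ^ 2 ≤ H x * (2 * x) ^ 2 := by
        have := hF.neg_mul_re_deriv_nonneg x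
        gcongr
        linarith
      linarith
    rw [div_mul_eq_mul_div, div_le_iff₀ (by linarith)]
    nlinarith
  -- the zeros of the lower bound are filled in by `sin² + cos² = 1`, using a half-integer translate
  have hsum : Integrable fun x : ℝ => H x + H (x + 1 / 2) := hHint.add (hHint.comp_add_right _)
  have hinv : IntegrableOn (fun x : ℝ => c / 8 * x⁻¹) (Ioi (max R 1)) := by
    refine Integrable.mono' hsum.integrableOn
      ((measurable_inv.const_mul _).aestronglyMeasurable) ?_
    filter_upwards [ae_restrict_mem measurableSet_Ioi] with x hx
    have hxR : R ≤ x := (le_max_left _ _).trans (le_of_lt hx)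
    have hx1 : 1 ≤ x := (le_max_right _ _).trans (le_of_lt hx)
    have h3 := hlow x hxR hx1
    have h4 := hlow (x + 1 / 2) (by linarith) (by linarith)
    have h5 : Real.sin (Real.pi * (x + 1 / 2)) = Real.cos (Real.pi * x) := by
      rw [mul_add, mul_one_div, Real.sin_add_pi_div_two]
    rw [h5] at h4
    rw [Real.norm_of_nonneg (by positivity)]
    have h6 : c / 8 * x⁻¹ ≤ c / (4 * x) := by
      rw [← div_eq_mul_inv, div_div]
      gcongr
      linarith
    have h7 : c / 8 * x⁻¹ ≤ c / (4 * (x + 1 / 2)) := by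
      rw [← div_eq_mul_inv, div_div]
      exact div_le_div_of_nonneg_left hc.le (by linarith) (by linarith)
    have h8 := Real.sin_sq_add_cos_sq (Real.pi * x)
    calc c / 8 * x⁻¹ = c / 8 * x⁻¹ * Real.sin (Real.pi * x) ^ 2 +
          c / 8 * x⁻¹ * Real.cos (Real.pi * x) ^ 2 := by rw [← mul_add, h8, mul_one]
      _ ≤ c / (4 * x) * Real.sin (Real.pi * x) ^ 2 +
          c / (4 * (x + 1 / 2)) * Real.cos (Real.pi * x) ^ 2 := by gcongr
      _ ≤ _ := add_le_add h3 h4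
  refine not_integrableOn_Ioi_inv (a := max R 1) ?_
  have := hinv.const_mul (c / 8)⁻¹
  refine this.congr (Eventually.of_forall fun x => ?_)
  simp only
  rw [inv_mul_cancel_left₀ (by positivity)]

lemma deriv_eq (hF : IsMonotoneSignMajorant F) (h2 : signExcess F = 2) (z : ℂ) :
    deriv F z = -2 * entireKernel z := by
  have hfin : signExcess F ≠ ⊤ := by rw [h2]; exact ENNReal.ofNat_ne_top
  obtain ⟨a, ha⟩ := hF.exists_const_deriv h2
  have hE : deriv F = fun z => a * (Real.pi : ℂ) ^ 2 * entireKernel z := by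
    refine Continuous.ext_on (s := {0, -1}ᶜ)
      ((toFinite _).countable.dense_compl ℂ) hF.realEntire.deriv.differentiable.continuous
      (differentiable_entireKernel.continuous.const_mul _) fun w hw => ?_
    simp only [mem_compl_iff, mem_insert_iff, mem_singleton_iff, not_or] at hw
    have hw1 : w + 1 ≠ 0 := fun h => hw.2 (eq_neg_of_add_eq_zero_left h)
    refine mul_right_cancel₀ (mul_ne_zero hw.1 (pow_ne_zero 2 hw1)) ?_
    rw [ha, ← pi_sq_mul_entireKernel]
    ring
  have hI : ∫ x : ℝ, deriv F x = 2 := by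
    have h := hF.integral_re_deriv hfin
    calc ∫ x : ℝ, deriv F x = ∫ x : ℝ, (((deriv F x).re : ℝ) : ℂ) := by
          simp_rw [hF.realEntire.deriv.ofReal_re]
      _ = 2 := by rw [integral_complex_ofReal, h]; norm_num
  rw [hE] at hI
  simp only at hI
  rw [integral_const_mul, integral_entireKernel] at hI
  rw [hE]
  simp only
  linear_combination (-entireKernel z) * hI

end IsMonotoneSignMajorant

/-! ### The extremal function -/

lemma extremalKernel_ofReal_ae_eq :
    (fun s : ℝ => extremalKernel (s : ℂ)) =ᵐ[volume] fun s : ℝ => entireKernel s := by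
  filter_upwards [(toFinite ({0, -1} : Set ℝ)).countable.ae_notMem volume] with s hs
  simp only [mem_insert_iff, mem_singleton_iff, not_or] at hs
  exact extremalKernel_eq (by exact_mod_cast hs.1) (by exact_mod_cast hs.2)

lemma extremalKernel_mul_ae_eq (z : ℂ) :
    (fun t : ℝ => extremalKernel ((t : ℂ) * z) * z) =ᵐ[volume]
      fun t : ℝ => entireKernel (t * z) * z := by
  rcases eq_or_ne z 0 with rfl | hz
  · simp
  have hinj : Function.Injective fun t : ℝ => (t : ℂ) * z := fun a b hab => by
    simpa [hz] using hab
  have hfin : ((fun t : ℝ => (t : ℂ) * z) ⁻¹' {0, -1}).Finite :=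
    (toFinite _).preimage hinj.injOn
  filter_upwards [hfin.countable.ae_notMem volume] with t ht
  simp only [mem_preimage, mem_insert_iff, mem_singleton_iff, not_or] at ht
  rw [extremalKernel_eq ht.1 ht.2]

lemma continuous_entireKernel_mul (z : ℂ) :
    Continuous fun t : ℝ => entireKernel (t * z) * z := by
  have := differentiable_entireKernel.continuous
  fun_prop

lemma integrableOn_extremalKernel : IntegrableOn (fun s : ℝ => extremalKernel (s : ℂ)) (Iic 0) :=
  (integrable_entireKernel.congr extremalKernel_ofReal_ae_eq.symm).integrableOn

lemma intervalIntegrable_extremalKernel (z : ℂ) :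
    IntervalIntegrable (fun t : ℝ => extremalKernel ((t : ℂ) * z) * z) volume 0 1 :=
  ((continuous_entireKernel_mul z).intervalIntegrable 0 1).congr_ae
    (ae_restrict_of_ae (extremalKernel_mul_ae_eq z).symm)

lemma extremalM_eq (z : ℂ) : extremalM z = -2 * ((∫ s : ℝ in Iic 0, entireKernel s) +
    ∫ t : ℝ in (0 : ℝ)..1, entireKernel (t * z) * z) - 1 := by
  rw [extremalM, setIntegral_congr_ae measurableSet_Iic
      (extremalKernel_ofReal_ae_eq.mono fun s hs _ => hs),
    intervalIntegral.integral_congr_ae ((extremalKernel_mul_ae_eq z).mono fun t ht _ => ht)]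

/-- The integral along a segment from the origin, in terms of a primitive. -/
lemma integral_entireKernel_segment {P : ℂ → ℂ} (hP : ∀ z, HasDerivAt P (entireKernel z) z)
    (z : ℂ) : ∫ t : ℝ in (0 : ℝ)..1, entireKernel (t * z) * z = P z - P 0 := by
  have h : ∀ t : ℝ, HasDerivAt (fun t : ℝ => P (t * z)) (entireKernel (t * z) * z) t := by
    intro t
    have h1 : HasDerivAt (fun w : ℂ => P (w * z)) (entireKernel (t * z) * z) (t : ℂ) := by
      simpa [Function.comp_def] using
        (hP (t * z)).comp (t : ℂ) ((hasDerivAt_id (t : ℂ)).mul_const z)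
    exact h1.comp_ofReal
  rw [intervalIntegral.integral_eq_sub_of_hasDerivAt (fun t _ => h t)
    ((continuous_entireKernel_mul z).intervalIntegrable 0 1)]
  simp

lemma exists_primitive_entireKernel : ∃ P : ℂ → ℂ, ∀ z, HasDerivAt P (entireKernel z) z := by
  obtain ⟨P, hP⟩ := differentiable_entireKernel.isExactOn_univ
  exact ⟨P, fun z => hP z (mem_univ z)⟩

lemma hasDerivAt_extremalM (z : ℂ) : HasDerivAt extremalM (-2 * entireKernel z) z := by
  obtain ⟨P, hP⟩ := exists_primitive_entireKernel
  have h : extremalM = fun z => -2 * ((∫ s : ℝ in Iic 0, entireKernel s) + (P z - P 0)) - 1 := by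
    funext w
    rw [extremalM_eq, integral_entireKernel_segment hP]
  rw [h]
  exact ((((hP z).sub_const _).const_add _).const_mul _).sub_const _

lemma integral_Iic_add_intervalIntegral (x : ℝ) :
    (∫ s : ℝ in Iic 0, entireKernel s) + ∫ s : ℝ in (0 : ℝ)..x, entireKernel s =
      ∫ s : ℝ in Iic x, entireKernel s := by
  rw [← intervalIntegral.integral_Iic_sub_Iic integrable_entireKernel.integrableOn
    integrable_entireKernel.integrableOn]
  ring

lemma extremalM_ofReal (x : ℝ) :
    extremalM x = -2 * (∫ s : ℝ in Iic x, entireKernel s) - 1 := by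
  obtain ⟨P, hP⟩ := exists_primitive_entireKernel
  have h : ∫ s : ℝ in (0 : ℝ)..x, entireKernel s = P x - P 0 := by
    rw [intervalIntegral.integral_eq_sub_of_hasDerivAt (f := fun s : ℝ => P s)
      (fun t _ => (hP t).comp_ofReal) integrable_entireKernel.intervalIntegrable]
    simp
  rw [extremalM_eq, integral_entireKernel_segment hP, ← h, integral_Iic_add_intervalIntegral]

lemma entireKernel_ofReal_im (x : ℝ) : (entireKernel x).im = 0 := by
  have h1 := ofReal_re_sincPi x
  have h2 := ofReal_re_sincPi (x + 1)
  push_cast at h2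
  rw [entireKernel, ← h1, ← h2]
  simp

lemma isRealEntire_extremalM : IsRealEntire extremalM where
  differentiable z := (hasDerivAt_extremalM z).differentiableAt
  im_eq_zero x := by
    have h : ∀ s : ℝ, entireKernel s = (((entireKernel s).re : ℝ) : ℂ) := fun s =>
      Complex.ext rfl (by simp [entireKernel_ofReal_im])
    have h1 : ∫ s : ℝ in Iic x, entireKernel s =
        ((∫ s : ℝ in Iic x, (entireKernel s).re : ℝ) : ℂ) := by
      rw [← integral_complex_ofReal]
      exact integral_congr_ae (Eventually.of_forall h)
    rw [extremalM_ofReal, h1]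
    simp

lemma tendsto_extremalM_atBot : Tendsto (fun x : ℝ => (extremalM x).re) atBot (nhds (-1)) := by
  have h := intervalIntegral_tendsto_integral_Iic 0
    (integrable_entireKernel.integrableOn (s := Iic 0)) tendsto_id
  have h1 : Tendsto (fun x : ℝ => extremalM x) atBot (nhds (-1)) := by
    have h2 := ((((tendsto_const_nhds (x := ∫ s : ℝ in Iic 0, entireKernel s)).sub h).const_mul
      (-2)).sub_const 1)
    rw [sub_self, mul_zero, zero_sub] at h2
    refine h2.congr fun x => ?_
    rw [extremalM_ofReal, ← integral_Iic_add_intervalIntegral x,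
      intervalIntegral.integral_symm x 0, id]
    ring
  simpa [Function.comp_def] using (Complex.continuous_re.tendsto _).comp h1

lemma tendsto_extremalM_atTop : Tendsto (fun x : ℝ => (extremalM x).re) atTop (nhds 1) := by
  have h := intervalIntegral_tendsto_integral_Ioi 0
    (integrable_entireKernel.integrableOn (s := Ioi 0)) tendsto_id
  have h1 : Tendsto (fun x : ℝ => extremalM x) atTop (nhds 1) := by
    have h2 := ((h.const_add (∫ s : ℝ in Iic 0, entireKernel s)).const_mul (-2)).sub_const 1
    rw [intervalIntegral.integral_Iic_add_Ioi integrable_entireKernel.integrableOn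
      integrable_entireKernel.integrableOn, integral_entireKernel] at h2
    norm_num at h2
    refine h2.congr fun x => ?_
    rw [extremalM_ofReal, ← integral_Iic_add_intervalIntegral x]
    ring
  simpa [Function.comp_def] using (Complex.continuous_re.tendsto _).comp h1

lemma mul_re_entireKernel (x : ℝ) : x * (entireKernel x).re = (sincPi (x + 1)).re ^ 2 := by
  have h := congrArg Complex.re (mul_entireKernel x)
  have h2 := ofReal_re_sincPi (x + 1)
  push_cast at h2
  rw [Complex.re_ofReal_mul, ← h2, ← Complex.ofReal_pow, Complex.ofReal_re] at h
  exact h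

lemma hasDerivAt_re_extremalM (x : ℝ) :
    HasDerivAt (fun x : ℝ => (extremalM x).re) (-2 * (entireKernel x).re) x := by
  simpa using (hasDerivAt_extremalM x).real_of_complex

lemma re_entireKernel_nonneg {x : ℝ} (hx : 0 < x) : 0 ≤ (entireKernel x).re := by
  have := mul_re_entireKernel x
  exact nonneg_of_mul_nonneg_right (this ▸ sq_nonneg _) hx

lemma re_entireKernel_nonpos {x : ℝ} (hx : x < 0) : (entireKernel x).re ≤ 0 := by
  have := mul_re_entireKernel x
  nlinarith [sq_nonneg (sincPi (x + 1)).re]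

lemma antitoneOn_extremalM : AntitoneOn (fun x : ℝ => (extremalM x).re) (Ici 0) :=
  antitoneOn_of_deriv_nonpos (convex_Ici 0)
    (fun x _ => (hasDerivAt_re_extremalM x).continuousAt.continuousWithinAt)
    (fun x _ => (hasDerivAt_re_extremalM x).differentiableAt.differentiableWithinAt)
    fun x hx => by
      rw [interior_Ici] at hx
      rw [(hasDerivAt_re_extremalM x).deriv]
      linarith [re_entireKernel_nonneg hx]

lemma monotoneOn_extremalM : MonotoneOn (fun x : ℝ => (extremalM x).re) (Iic 0) :=
  monotoneOn_of_deriv_nonneg (convex_Iic 0)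
    (fun x _ => (hasDerivAt_re_extremalM x).continuousAt.continuousWithinAt)
    (fun x _ => (hasDerivAt_re_extremalM x).differentiableAt.differentiableWithinAt)
    fun x hx => by
      rw [interior_Iic] at hx
      rw [(hasDerivAt_re_extremalM x).deriv]
      linarith [re_entireKernel_nonpos hx]

lemma one_le_extremalM {x : ℝ} (hx : 0 ≤ x) : 1 ≤ (extremalM x).re := by
  refine le_of_tendsto tendsto_extremalM_atTop ?_
  filter_upwards [eventually_ge_atTop x] with y hy
  exact antitoneOn_extremalM hx (hx.trans hy) hy

lemma neg_one_le_extremalM {x : ℝ} (hx : x ≤ 0) : -1 ≤ (extremalM x).re := by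
  refine le_of_tendsto tendsto_extremalM_atBot ?_
  filter_upwards [eventually_le_atBot x] with y hy
  exact monotoneOn_extremalM (hy.trans hx) hx hy

lemma exponentialType_extremalM_le : exponentialType extremalM ≤ ((2 * Real.pi : ℝ) : EReal) := by
  obtain ⟨C, hC⟩ := exists_norm_entireKernel_le
  have hC0 : 0 ≤ C := by simpa using (norm_nonneg _).trans (hC 0)
  set A : ℝ := 2 * ‖∫ s : ℝ in Iic 0, entireKernel s‖ + 1 with hA
  have hA0 : 0 ≤ A := by positivity
  have hM : ∀ z : ℂ, ‖extremalM z‖ ≤ A + 2 * (C * Real.exp (2 * Real.pi * ‖z‖) * ‖z‖) := by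
    intro z
    have h1 : ‖∫ t : ℝ in (0 : ℝ)..1, entireKernel (t * z) * z‖ ≤
        C * Real.exp (2 * Real.pi * ‖z‖) * ‖z‖ * |1 - 0| := by
      refine intervalIntegral.norm_integral_le_of_norm_le_const fun t ht => ?_
      rw [uIoc_of_le zero_le_one] at ht
      rw [norm_mul]
      gcongr
      refine (hC _).trans ((div_le_self (by positivity) (by linarith [sq_nonneg (t * z).re])).trans
        ?_)
      rw [Complex.im_ofReal_mul, abs_mul, abs_of_pos ht.1]
      gcongr
      calc t * |z.im| ≤ 1 * ‖z‖ := by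
            gcongr
            · exact ht.2
            · exact Complex.abs_im_le_norm z
        _ = ‖z‖ := one_mul _
    rw [sub_zero, abs_one, mul_one] at h1
    rw [extremalM_eq]
    refine (norm_sub_le _ _).trans ?_
    rw [norm_mul, norm_neg, Complex.norm_ofNat, norm_one]
    have h2 := norm_add_le (∫ s : ℝ in Iic 0, entireKernel s)
      (∫ t : ℝ in (0 : ℝ)..1, entireKernel (t * z) * z)
    linarith
  refine exponentialType_le_of_eventually fun ε hε => ?_
  have hbig : ∀ R : ℝ, ∀ᶠ z in Bornology.cobounded ℂ, R ≤ ‖z‖ := fun R =>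
    tendsto_norm_cobounded_atTop.eventually_ge_atTop R
  filter_upwards [hbig 1, hbig (2 * (A + 2 * C) / ε ^ 2)] with z h1 h2
  rw [div_le_iff₀ (by positivity)] at h2
  have h3 := Real.quadratic_le_exp_of_nonneg (x := ε * ‖z‖) (by positivity)
  have h4 : 1 ≤ Real.exp (2 * Real.pi * ‖z‖) := Real.one_le_exp (by positivity)
  have h5 : A + 2 * C * ‖z‖ ≤ Real.exp (ε * ‖z‖) := by
    have h6 : 0 ≤ ε * ‖z‖ := by positivity
    have h7 : 2 * (A + 2 * C) * ‖z‖ ≤ ‖z‖ * ε ^ 2 * ‖z‖ := by gcongr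
    nlinarith
  calc ‖extremalM z‖ ≤ A + 2 * (C * Real.exp (2 * Real.pi * ‖z‖) * ‖z‖) := hM z
    _ ≤ A * Real.exp (2 * Real.pi * ‖z‖) + 2 * (C * Real.exp (2 * Real.pi * ‖z‖) * ‖z‖) := by
        gcongr
        exact le_mul_of_one_le_right hA0 h4
    _ = Real.exp (2 * Real.pi * ‖z‖) * (A + 2 * C * ‖z‖) := by ring
    _ ≤ Real.exp (2 * Real.pi * ‖z‖) * Real.exp (ε * ‖z‖) := by gcongr
    _ = _ := by rw [← Real.exp_add, add_mul]

lemma isMonotoneSignMajorant_extremalM : IsMonotoneSignMajorant extremalM where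
  realEntire := isRealEntire_extremalM
  exponentialType_le := exponentialType_extremalM_le
  sign_le x := by
    rcases lt_or_ge x 0 with h | h
    · rw [Real.sign_of_neg h]
      exact neg_one_le_extremalM h.le
    · refine le_trans ?_ (one_le_extremalM h)
      rcases Real.sign_apply_eq x with h | h | h <;> rw [h] <;> norm_num
  monotoneOn := monotoneOn_extremalM.mono Iio_subset_Iic_self
  antitoneOn := antitoneOn_extremalM.mono Ioi_subset_Ici_self

lemma signExcess_extremalM : signExcess extremalM = 2 := by
  have hc : Continuous fun x : ℝ => -2 * (entireKernel x).re := by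
    exact continuous_const.mul (Complex.continuous_re.comp
      (differentiable_entireKernel.continuous.comp Complex.continuous_ofReal))
  have h1 := lintegral_sub_sign_eq hasDerivAt_re_extremalM hc
    (fun x hx => by linarith [re_entireKernel_nonneg hx])
    (fun x hx => by linarith [re_entireKernel_nonpos hx])
    tendsto_extremalM_atTop tendsto_extremalM_atBot
  have hS : ∀ x : ℝ, sincPi ((x + 1 : ℝ) : ℂ) ^ 2 = (((sincPi (x + 1)).re ^ 2 : ℝ) : ℂ) := by
    intro x
    have := ofReal_re_sincPi (x + 1)
    push_cast at this ⊢
    rw [this]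
  have hI : Integrable fun x : ℝ => 2 * (sincPi (x + 1)).re ^ 2 := by
    have := (integrable_sincPi_sq.comp_add_right 1).re
    simp_rw [hS] at this
    exact this.const_mul 2
  have hval : ∫ x : ℝ, 2 * (sincPi (x + 1)).re ^ 2 = 2 := by
    have h2 := integral_add_right_eq_self (μ := volume) (fun x : ℝ => sincPi x ^ 2) 1
    simp_rw [hS] at h2
    rw [integral_sincPi_sq, integral_complex_ofReal] at h2
    rw [integral_const_mul, show ∫ x : ℝ, (sincPi (x + 1)).re ^ 2 = 1 by exact_mod_cast h2,
      mul_one]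
  calc signExcess extremalM = ∫⁻ x : ℝ, ENNReal.ofReal (-x * (-2 * (entireKernel x).re)) := h1
    _ = ∫⁻ x : ℝ, ENNReal.ofReal (2 * (sincPi (x + 1)).re ^ 2) := by
        congr 1 with x
        rw [← mul_re_entireKernel]
        ring_nf
    _ = 2 := by
        rw [← ofReal_integral_eq_lintegral_ofReal hI
          (Eventually.of_forall fun x => by positivity), hval, ENNReal.ofReal_ofNat]

/-- An extremal function has the same derivative and the same limit at `-∞` as `extremalM`. -/
lemma IsMonotoneSignMajorant.eq_extremalM {F : ℂ → ℂ} (hF : IsMonotoneSignMajorant F)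
    (h2 : signExcess F = 2) : F = extremalM := by
  have hfin : signExcess F ≠ ⊤ := by rw [h2]; exact ENNReal.ofNat_ne_top
  have hd : ∀ z, HasDerivAt (fun z => F z - extremalM z) 0 z := fun z => by
    have := (hF.realEntire.differentiable z).hasDerivAt.fun_sub (hasDerivAt_extremalM z)
    rwa [hF.deriv_eq h2, sub_self] at this
  have hconst : ∀ z, F z - extremalM z = F 0 - extremalM 0 := fun z =>
    is_const_of_deriv_eq_zero (fun z => (hd z).differentiableAt) (fun z => (hd z).deriv) z 0
  have hlim := (hF.tendsto_atBot hfin).sub tendsto_extremalM_atBot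
  rw [sub_self] at hlim
  have hre : (F 0 - extremalM 0).re = 0 := by
    refine tendsto_nhds_unique (tendsto_const_nhds.congr fun x : ℝ => ?_) hlim
    rw [← hconst x, Complex.sub_re]
  have him : (F 0 - extremalM 0).im = 0 := by
    have h3 := hF.realEntire.im_eq_zero 0
    have h4 := isRealEntire_extremalM.im_eq_zero 0
    rw [Complex.ofReal_zero] at h3 h4
    rw [Complex.sub_im, h3, h4, sub_zero]
  funext z
  rw [← sub_eq_zero, hconst]
  exact Complex.ext hre him

theorem theorem1 :
    (∀ F : ℂ → ℂ, IsMonotoneSignMajorant F → 2 ≤ signExcess F) ∧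
    (IntegrableOn (fun s : ℝ => extremalKernel (s : ℂ)) (Iic 0) ∧
      ∀ z : ℂ, IntervalIntegrable (fun t : ℝ => extremalKernel ((t : ℂ) * z) * z) volume 0 1) ∧
    (IsMonotoneSignMajorant extremalM ∧ signExcess extremalM = 2) ∧
    (∀ F : ℂ → ℂ, IsMonotoneSignMajorant F → signExcess F = 2 → F = extremalM) :=
  ⟨fun _ hF => hF.two_le_signExcess,
    ⟨integrableOn_extremalKernel, intervalIntegrable_extremalKernel⟩,
    ⟨isMonotoneSignMajorant_extremalM, signExcess_extremalM⟩,
    fun _ hF h => hF.eq_extremalM h⟩
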